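/- Let $p$ be a prime and let $S$ be a finite totally ordered set. Words in $S$ are the elements of the free monoid on $S$, whose product is tensor concatenation $\otimes$. Let Ш$_{\mathbb F_p,0}(S)$ be the shuffle algebra: the $\mathbb F_p$-vector space with basis all words in $S$, with bilinear product given on words $u,v$ by the sum, with multiplicity, of all shuffles of $u$ and $v$ (interleavings that keep the order of the letters of $u$ and of those of $v$), and with the empty word as unit. Order words lexicographically, a proper prefix of a word being smaller than the word. A Lyndon word is a nonempty word $w$ such that $w<v$ whenever $w=u\otimes v$ with $u,v$ nonempty. Let $$TL=\{\,w^{\otimes p^j}\ :\ w \text{ a Lyndon word},\ j\ge 0\,\}$$ be the set of $p$-power tensor powers of Lyndon words, and let $\mathbb F_p[\overline{TL}]$ be the polynomial algebra on a set of symbols $\overline w$ in bijection with the words $w\in TL$. Then there are isomorphisms of $\mathbb F_p$-algebras $$\text{Ш}_{\mathbb F_p,0}(S)\;\cong\;\mathbb F_p[\overline{TL}]\big/\big\langle \overline w^{\,p} : w\in TL\big\rangle\;\cong\;\bigotimes_{w\in TL}\mathbb F_p[\overline w]/\langle \overline w^{\,p}\rangle .$$ The first can be chosen so that the class of $\overline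 w$ corresponds to the word $w$, and the second so that the class of $\overline w$ corresponds to the image of $\overline w$ in the factor with index $w$, for every $w\in TL$. Here the tensor product of the (possibly infinite) family of algebras over $\mathbb F_p$ is the direct limit of the tensor products over its finite subfamilies. -/

import Mathlib

open scoped TensorProduct

/-! ### The shuffle algebra (mixable shuffle algebra of weight zero) on a set of letters -/

/-- The list, with multiplicities, of all shuffles of two words: the words obtained by interleaving
the letters of `u` and `v` while keeping the order of the letters of `u` and of those of `v`. -/
def shuffles {S : Type*} : List S → List S → List (List S)
  | [], v => [v]
  | a :: u, [] => [a :: u]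
  | a :: u, b :: v =>
      (shuffles u (b :: v)).map (List.cons a) ++ (shuffles (a :: u) v).map (List.cons b)
termination_by u v => u.length + v.length

/-- The underlying module of the shuffle algebra: the free `k`-module on the words in `S`. A word
`s₁ ⊗ ⋯ ⊗ sₙ` is the list `[s₁, …, sₙ]`, and tensor concatenation is `++`. -/
def ShuffleAlgebra (k : Type*) [CommRing k] (S : Type*) : Type _ := List S →₀ k

namespace ShuffleAlgebra

variable {k : Type*} [CommRing k] {S : Type*}

noncomputable instance : AddCommGroup (ShuffleAlgebra k S) :=
  inferInstanceAs (AddCommGroup (List S →₀ k))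

noncomputable instance : Module k (ShuffleAlgebra k S) :=
  inferInstanceAs (Module k (List S →₀ k))

variable (k) in
/-- A word, as an element of the shuffle algebra. -/
noncomputable def word (w : List S) : ShuffleAlgebra k S := Finsupp.single w 1

theorem hom_ext {M : Type*} [AddCommGroup M] [Module k M] {f g : ShuffleAlgebra k S →ₗ[k] M}
    (h : ∀ w, f (word k w) = g (word k w)) : f = g :=
  Finsupp.lhom_ext' fun w => LinearMap.ext_ring (h w)

variable (k) in
/-- The shuffle product of two words: the sum of all their shuffles. -/
noncomputable def wordMul (u v : List S) : ShuffleAlgebra k S :=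
  ((shuffles u v).map (word k)).sum

/-- The linear map with prescribed values on words. -/
noncomputable def liftWords {M : Type*} [AddCommGroup M] [Module k M] (f : List S → M) :
    ShuffleAlgebra k S →ₗ[k] M :=
  Finsupp.linearCombination k f

@[simp] theorem liftWords_word {M : Type*} [AddCommGroup M] [Module k M] (f : List S → M)
    (w : List S) : liftWords (k := k) f (word k w) = f w :=
  (Finsupp.linearCombination_single k (1 : k) w).trans (one_smul k (f w))

/-- The shuffle product, extended bilinearly from words. -/
noncomputable def mulHom :
    ShuffleAlgebra k S →ₗ[k] ShuffleAlgebra k S →ₗ[k] ShuffleAlgebra k S :=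
  liftWords fun u => liftWords fun v => wordMul k u v

/-- Prefixing a letter. -/
noncomputable def consHom (a : S) : ShuffleAlgebra k S →ₗ[k] ShuffleAlgebra k S :=
  liftWords fun w => word k (a :: w)

@[simp] theorem consHom_word (a : S) (w : List S) : consHom a (word k w) = word k (a :: w) := by
  simp [consHom]

theorem mulHom_word (u v : List S) : mulHom (word k u) (word k v) = wordMul k u v := by
  simp [mulHom]

theorem wordMul_nil_left (v : List S) : wordMul k [] v = word k v := by
  simp [wordMul, shuffles]

theorem wordMul_nil_right (v : List S) : wordMul k v [] = word k v := by
  cases v <;> simp [wordMul, shuffles]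

theorem consHom_sum (a : S) (l : List (List S)) :
    consHom a (l.map (word k)).sum = ((l.map (List.cons a)).map (word k)).sum := by
  rw [map_list_sum, List.map_map, List.map_map]
  congr 2
  funext w
  simp

theorem wordMul_cons (a b : S) (u v : List S) :
    wordMul k (a :: u) (b :: v)
      = consHom a (wordMul k u (b :: v)) + consHom b (wordMul k (a :: u) v) := by
  simp only [wordMul, consHom_sum]
  rw [shuffles, List.map_append, List.sum_append]

theorem mulHom_consHom (a b : S) (x y : ShuffleAlgebra k S) :
    mulHom (consHom a x) (consHom b y)
      = consHom a (mulHom x (consHom b y)) + consHom b (mulHom (consHom a x) y) := by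
  have h : (mulHom.compl₁₂ (consHom a) (consHom b) :
        ShuffleAlgebra k S →ₗ[k] ShuffleAlgebra k S →ₗ[k] ShuffleAlgebra k S)
      = (mulHom.compl₂ (consHom b)).compr₂ (consHom a)
        + (mulHom.comp (consHom a)).compr₂ (consHom b) := by
    refine hom_ext fun u => hom_ext fun v => ?_
    simp [mulHom_word, wordMul_cons]
  exact LinearMap.congr_fun (LinearMap.congr_fun h x) y

theorem wordMul_comm : ∀ u v : List S, wordMul k u v = wordMul k v u
  | [], v => by rw [wordMul_nil_left, wordMul_nil_right]
  | a :: u, [] => by rw [wordMul_nil_left, wordMul_nil_right]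
  | a :: u, b :: v => by
      rw [wordMul_cons, wordMul_cons, wordMul_comm u (b :: v), wordMul_comm (a :: u) v, add_comm]
termination_by u v => u.length + v.length

theorem mulHom_comm (x y : ShuffleAlgebra k S) : mulHom x y = mulHom y x := by
  have h : (mulHom : ShuffleAlgebra k S →ₗ[k] _) = mulHom.flip := by
    refine hom_ext fun u => hom_ext fun v => ?_
    rw [LinearMap.flip_apply, mulHom_word, mulHom_word, wordMul_comm]
  exact LinearMap.congr_fun (LinearMap.congr_fun h x) y

theorem nil_mulHom (x : ShuffleAlgebra k S) : mulHom (word k []) x = x := by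
  have h : (mulHom (word k []) : ShuffleAlgebra k S →ₗ[k] _) = LinearMap.id :=
    hom_ext fun v => by rw [mulHom_word, wordMul_nil_left, LinearMap.id_apply]
  exact LinearMap.congr_fun h x

theorem mulHom_nil (x : ShuffleAlgebra k S) : mulHom x (word k []) = x := by
  rw [mulHom_comm, nil_mulHom]

theorem mulHom_assoc_word : ∀ u v w : List S,
    mulHom (mulHom (word k u) (word k v)) (word k w)
      = mulHom (word k u) (mulHom (word k v) (word k w))
  | [], v, w => by rw [nil_mulHom, nil_mulHom]
  | u, [], w => by rw [nil_mulHom, mulHom_nil]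
  | u, v, [] => by rw [mulHom_nil, mulHom_nil]
  | a :: u, b :: v, c :: w => by
      have h1 := mulHom_assoc_word u (b :: v) (c :: w)
      have h2 := mulHom_assoc_word (a :: u) v (c :: w)
      have h3 := mulHom_assoc_word (a :: u) (b :: v) w
      simp only [← consHom_word] at h1 h2 h3 ⊢
      simp only [mulHom_consHom, map_add, LinearMap.add_apply] at h1 h2 h3 ⊢
      have h1' := congrArg (consHom a) h1
      have h3' := congrArg (consHom c) h3
      simp only [map_add] at h1' h3'
      rw [← h2, ← h3', h1']
      abel
termination_by u v w => u.length + v.length + w.length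

theorem induction_words {P : ShuffleAlgebra k S → Prop} (hw : ∀ w, P (word k w))
    (hz : P 0) (ha : ∀ x y, P x → P y → P (x + y)) (hs : ∀ (c : k) x, P x → P (c • x))
    (x : ShuffleAlgebra k S) : P x := by
  refine Finsupp.induction_linear (motive := P) x hz ha fun w c => ?_
  have h : (Finsupp.single w c : List S →₀ k) = c • Finsupp.single w 1 := by simp
  rw [h]
  exact hs c _ (hw w)

theorem mulHom_assoc (x y z : ShuffleAlgebra k S) :
    mulHom (mulHom x y) z = mulHom x (mulHom y z) := by
  induction x using induction_words with
  | hz => simp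
  | ha x x' h h' => simp [h, h']
  | hs c x h => simp [h]
  | hw u =>
    induction y using induction_words with
    | hz => simp
    | ha x x' h h' => simp [h, h']
    | hs c x h => simp [h]
    | hw v =>
      induction z using induction_words with
      | hz => simp
      | ha x x' h h' => simp [h, h']
      | hs c x h => simp [h]
      | hw w => exact mulHom_assoc_word u v w

/-- The commutative ring structure given by the shuffle product, with the empty word as unit. -/
noncomputable instance : CommRing (ShuffleAlgebra k S) where
  __ := (inferInstance : AddCommGroup (ShuffleAlgebra k S))
  mul x y := mulHom x y
  one := word k []
  left_distrib x y z := map_add (mulHom x) y z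
  right_distrib x y z := LinearMap.map_add₂ mulHom x y z
  zero_mul x := LinearMap.map_zero₂ mulHom x
  mul_zero x := map_zero (mulHom x)
  mul_assoc x y z := mulHom_assoc x y z
  one_mul x := nil_mulHom x
  mul_one x := mulHom_nil x
  mul_comm x y := mulHom_comm x y

noncomputable instance : Algebra k (ShuffleAlgebra k S) :=
  Algebra.ofModule (fun c x y => LinearMap.map_smul₂ mulHom c x y)
    (fun c x y => map_smul (mulHom x) c y)

theorem one_def : (1 : ShuffleAlgebra k S) = word k [] := rfl

theorem word_mul_word (u v : List S) :
    word k u * word k v = ((shuffles u v).map (word k)).sum :=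
  mulHom_word u v

end ShuffleAlgebra

/-! ### Lyndon words and their `p`-power tensor powers -/

/-- A nonempty word `w` is a Lyndon word if `w < v` for every factorization `w = u ⊗ v` into
nonempty words. Here `<` on lists is the lexicographic order, in which a proper prefix of a word is
smaller than that word. -/
def IsLyndon {S : Type*} [LinearOrder S] (w : List S) : Prop :=
  w ≠ [] ∧ ∀ u v : List S, u ≠ [] → v ≠ [] → w = u ++ v → w < v

/-- The tensor power `w ⊗ ⋯ ⊗ w` (`n` factors) of a word. -/
def tensorPow {S : Type*} (w : List S) (n : ℕ) : List S :=
  (List.replicate n w).flatten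

/-- The set `TL` of words `w^{⊗ p ^ j}`, with `w` a Lyndon word and `j ≥ 0`. -/
def TL (p : ℕ) (S : Type*) [LinearOrder S] : Set (List S) :=
  {w | ∃ u : List S, IsLyndon u ∧ ∃ j : ℕ, w = tensorPow u (p ^ j)}

/-! ### The tensor product of a possibly infinite family of commutative algebras -/

namespace AlgTensor

variable (k : Type*) [CommRing k] {ι : Type*} (A : ι → Type*)
  [∀ i, CommRing (A i)] [∀ i, Algebra k (A i)]

open Classical in
/-- Extend a family indexed by `s` by `1`. -/
noncomputable def extendOne {s t : Finset ι} (x : ∀ i : s, A i) : ∀ i : t, A i :=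
  fun i => if h : i.1 ∈ s then x ⟨i.1, h⟩ else 1

variable {A} in
theorem extendOne_update {s t : Finset ι} [DecidableEq s] [DecidableEq t] (hst : s ≤ t)
    (x : ∀ i : s, A i) (i : s) (a : A i) :
    extendOne A (t := t) (Function.update x i a)
      = Function.update (extendOne A (t := t) x) ⟨i.1, hst i.2⟩ a := by
  funext l
  by_cases hl : l = ⟨i.1, hst i.2⟩
  · subst hl
    simp [extendOne]
  · rw [Function.update_of_ne hl]
    unfold extendOne
    split_ifs with h
    · rw [Function.update_of_ne]
      rintro rfl
      exact hl rfl
    · rfl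

open Classical in
/-- For finite sets `s ⊆ t`, the algebra map from the tensor product over `s` to the tensor product
over `t` that sends `⊗ xᵢ` to `⊗ yᵢ`, where `yᵢ = xᵢ` for `i ∈ s` and `yᵢ = 1` otherwise. -/
noncomputable def transition (s t : Finset ι) (hst : s ≤ t) :
    (⨂[k] i : s, A i) →ₐ[k] (⨂[k] i : t, A i) :=
  PiTensorProduct.liftAlgHom
    { toFun := fun x => PiTensorProduct.tprod k (extendOne A x)
      map_update_add' := by
        intro _ x i a b
        simp only [extendOne_update hst, MultilinearMap.map_update_add]
      map_update_smul' := by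
        intro _ x i c a
        simp only [extendOne_update hst, MultilinearMap.map_update_smul] }
    (by
      have h : extendOne A (s := s) (t := t) 1 = 1 := by
        funext i
        simp [extendOne]
      change PiTensorProduct.tprod k (extendOne A (s := s) (t := t) 1) = 1
      rw [h]
      rfl)
    (by
      intro x y
      have h : extendOne A (s := s) (t := t) (x * y) = extendOne A x * extendOne A y := by
        funext i
        by_cases hi : i.1 ∈ s <;> simp [extendOne, hi]
      change PiTensorProduct.tprod k (extendOne A (s := s) (t := t) (x * y)) =
        PiTensorProduct.tprod k (extendOne A x) * PiTensorProduct.tprod k (extendOne A y)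
      rw [h, PiTensorProduct.tprod_mul_tprod])

theorem transition_tprod (s t : Finset ι) (hst : s ≤ t) (x : ∀ i : s, A i) :
    transition k A s t hst (PiTensorProduct.tprod k x) =
      PiTensorProduct.tprod k (extendOne A x) := by
  simp [transition]

instance : DirectedSystem (fun s : Finset ι => ⨂[k] i : s, A i)
    (fun s t h => transition k A s t h) where
  map_self s x := by
    have h : (transition k A s s le_rfl).toLinearMap = LinearMap.id := by
      refine PiTensorProduct.ext (MultilinearMap.ext fun x => ?_)
      have hx : extendOne A (s := s) (t := s) x = x := by
        funext i
        simp [extendOne]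
      change transition k A s s le_rfl (PiTensorProduct.tprod k x) = PiTensorProduct.tprod k x
      rw [transition_tprod, hx]
    exact LinearMap.congr_fun h x
  map_map u t s hst htu x := by
    have h : (transition k A t u htu).toLinearMap ∘ₗ (transition k A s t hst).toLinearMap
        = (transition k A s u (hst.trans htu)).toLinearMap := by
      refine PiTensorProduct.ext (MultilinearMap.ext fun x => ?_)
      have hx : extendOne A (s := t) (t := u) (extendOne A x) = extendOne A x := by
        funext i
        by_cases hi : i.1 ∈ s
        · simp [extendOne, hi, hst hi]
        · simp [extendOne, hi]
      change transition k A t u htu (transition k A s t hst (PiTensorProduct.tprod k x))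
        = transition k A s u (hst.trans htu) (PiTensorProduct.tprod k x)
      rw [transition_tprod, transition_tprod, transition_tprod, hx]
    exact LinearMap.congr_fun h x

end AlgTensor

/-- The tensor product over `k` of a family of commutative `k`-algebras: the direct limit of the
tensor products over the finite subfamilies. -/
def AlgTensor (k : Type*) [CommRing k] {ι : Type*} (A : ι → Type*)
    [∀ i, CommRing (A i)] [∀ i, Algebra k (A i)] : Type _ :=
  DirectLimit (fun s : Finset ι => ⨂[k] i : s, A i) (AlgTensor.transition k A)

namespace AlgTensor

variable (k : Type*) [CommRing k] {ι : Type*} (A : ι → Type*)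
  [∀ i, CommRing (A i)] [∀ i, Algebra k (A i)]

noncomputable instance : CommRing (AlgTensor k A) :=
  inferInstanceAs (CommRing (DirectLimit (fun s : Finset ι => ⨂[k] i : s, A i)
    (AlgTensor.transition k A)))

noncomputable instance : Algebra k (AlgTensor k A) :=
  letI : Module k (AlgTensor k A) :=
    inferInstanceAs (Module k (DirectLimit (fun s : Finset ι => ⨂[k] i : s, A i)
      (AlgTensor.transition k A)))
  Algebra.ofModule
    (fun c x y => smul_mul_assoc (α := k) (β := DirectLimit (fun s : Finset ι => ⨂[k] i : s, A i)
      (AlgTensor.transition k A)) c x y)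
    (fun c x y => mul_smul_comm (α := k) (β := DirectLimit (fun s : Finset ι => ⨂[k] i : s, A i)
      (AlgTensor.transition k A)) c x y)

/-- The class of an element of the tensor product of a finite subfamily. -/
noncomputable def mk (s : Finset ι) (x : ⨂[k] i : s, A i) : AlgTensor k A :=
  (⟦⟨s, x⟩⟧ : DirectLimit (fun s : Finset ι => ⨂[k] i : s, A i) (AlgTensor.transition k A))

theorem mk_add (s : Finset ι) (x y : ⨂[k] i : s, A i) :
    mk k A s (x + y) = mk k A s x + mk k A s y :=
  (DirectLimit.add_def (G := fun s : Finset ι => ⨂[k] i : s, A i)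
    (f := AlgTensor.transition k A) s x y).symm

theorem mk_mul (s : Finset ι) (x y : ⨂[k] i : s, A i) :
    mk k A s (x * y) = mk k A s x * mk k A s y :=
  (DirectLimit.mul_def (G := fun s : Finset ι => ⨂[k] i : s, A i)
    (f := AlgTensor.transition k A) s x y).symm

theorem mk_one (s : Finset ι) : mk k A s 1 = 1 :=
  (DirectLimit.one_def (G := fun s : Finset ι => ⨂[k] i : s, A i)
    (f := AlgTensor.transition k A) s).symm

theorem mk_smul (s : Finset ι) (c : k) (x : ⨂[k] i : s, A i) :
    mk k A s (c • x) = c • mk k A s x :=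
  (DirectLimit.smul_def (G := fun s : Finset ι => ⨂[k] i : s, A i)
    (f := AlgTensor.transition k A) s x c).symm

/-- The canonical map from the tensor product of a finite subfamily. -/
noncomputable def ofFinset (s : Finset ι) : (⨂[k] i : s, A i) →ₐ[k] AlgTensor k A :=
  AlgHom.ofLinearMap
    { toFun := mk k A s
      map_add' := mk_add k A s
      map_smul' := mk_smul k A s }
    (mk_one k A s) (mk_mul k A s)

open Classical in
/-- The canonical map from the factor with index `i`. -/
noncomputable def of (i : ι) : A i →ₐ[k] AlgTensor k A :=
  (ofFinset k A {i}).comp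
    (PiTensorProduct.singleAlgHom (A := fun j : ({i} : Finset ι) => A j)
      ⟨i, Finset.mem_singleton_self i⟩)

end AlgTensor

/-!
The shuffle algebra `ShuffleAlgebra k S` has the words as a basis, and the theorem compares this
basis with the products of words in `TL` in which every factor occurs less than `p` times.

*Relations.* Removing a prescribed first letter is a derivation `D` of the shuffle algebra, so in
characteristic `p` one has `D (x ^ p) = p x ^ (p - 1) D x = 0`. An element without constant term
that all these derivations kill is zero, hence `w ^ p = 0` for every nonempty word `w`
(`ShuffleAlgebra.word_pow_char_eq_zero`).

*Leading terms.* By Chen, Fox and Lyndon every word is the product of a unique nonincreasing list of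
Lyndon words (`exists_isLyndonList_flatten`, `IsLyndonList.eq_of_flatten_eq`). The lexicographically
largest shuffle of two nonincreasing products of Lyndon words is the nonincreasing product of all
their factors (`shuffle_le_flatten`). The reason is that, for a Lyndon word `l`, the words which are
at most the infinite periodic word `l l l ⋯` are closed under shuffles (`PowBounded.shuffle`), and
that the first block of length `|l|` of such a shuffle can equal `l` only if it comes entirely from
one of the two words (`shuffle_block`). Both are proved by induction on the length of `l`: two words
shorter than `l` and bounded by `l l l ⋯` are already bounded by `a a a ⋯`, where `a < l` is the
first Lyndon factor of `l` without its last letter, whereas `l` is not. Taking blocks one at a time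
gives Pascal's rule, so the largest shuffle of `l^{⊗ a}` with a product that contains `b` factors
`l` occurs `(a + b).choose a` times (`shuffleCount_tensorPow_flatten`).

*Digits.* In a product of words in `TL` with multiplicities less than `p`, the multiplicities of the
words `l^{⊗ p ^ j}`, `j ≥ 0`, are the base `p` digits of the number of factors `l` in the leading
word. Hence these products correspond bijectively to their leading words, which are all words
(`leadingWord_injOn`, `exists_leadingWord_eq`). Multiplying by a further `l^{⊗ p ^ j}` produces no
carry, so by Lucas' theorem the binomial coefficients that occur are prime to `p`
(`exists_hasLeadingTerm_prod`). Interleaving along a fixed pattern is strictly monotone, so leading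
terms multiply, and triangularity shows that the products form a basis. This is the first
isomorphism; the second is formal, from the universal property of the tensor product of a family of
commutative algebras (`AlgTensor.lift`).
-/

/-! ### First letter derivations and `p`-th powers of words -/

namespace ShuffleAlgebra

section Derivation

variable {k : Type*} [CommRing k] {S : Type*}

/-- The coefficient of a word, as a linear functional. -/
noncomputable def coeff (s : List S) : ShuffleAlgebra k S →ₗ[k] k :=
  Finsupp.lapply (M := k) s

theorem coeff_word [DecidableEq S] (s w : List S) :
    coeff s (word k w) = if w = s then 1 else 0 := by
  classical
  refine (Finsupp.single_apply (a := w) (a' := s) (b := (1 : k))).trans ?_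
  split_ifs <;> rfl

theorem ext_coeff {x y : ShuffleAlgebra k S} (h : ∀ s, coeff s x = coeff s y) : x = y :=
  Finsupp.ext h

open Classical in
/-- Removal of a prescribed first letter `c`; words that do not start with `c` go to `0`. -/
noncomputable def uncons (c : S) : ShuffleAlgebra k S →ₗ[k] ShuffleAlgebra k S :=
  liftWords fun w => if w.head? = some c then word k w.tail else 0

theorem uncons_word [DecidableEq S] (c : S) (w : List S) :
    uncons c (word k w) = if w.head? = some c then word k w.tail else 0 := by
  rw [uncons, liftWords_word]
  split_ifs <;> rfl

theorem uncons_consHom [DecidableEq S] (c a : S) (x : ShuffleAlgebra k S) :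
    uncons c (consHom a x) = if a = c then x else 0 := by
  have h : (uncons c).comp (consHom a)
      = (if a = c then LinearMap.id else 0 : ShuffleAlgebra k S →ₗ[k] ShuffleAlgebra k S) := by
    refine hom_ext fun w => ?_
    by_cases hac : a = c <;> simp [uncons_word, hac]
  have := LinearMap.congr_fun h x
  split_ifs at this ⊢ <;> simpa using this

theorem coeff_uncons (c : S) (s : List S) (x : ShuffleAlgebra k S) :
    coeff s (uncons c x) = coeff (c :: s) x := by
  classical
  have h : (coeff s).comp (uncons c) = (coeff (c :: s) : ShuffleAlgebra k S →ₗ[k] k) := by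
    refine hom_ext fun w => ?_
    rw [LinearMap.comp_apply, uncons_word]
    rcases w with _ | ⟨a, w⟩
    · simp [coeff_word]
    · by_cases hac : a = c <;> simp [coeff_word, hac]
  exact LinearMap.congr_fun h x

theorem uncons_mul (c : S) (x y : ShuffleAlgebra k S) :
    uncons c (x * y) = x * uncons c y + y * uncons c x := by
  classical
  have hw : ∀ u v : List S, uncons c (mulHom (word k u) (word k v))
      = mulHom (word k u) (uncons c (word k v)) + mulHom (uncons c (word k u)) (word k v) := by
    intro u v
    rcases u with _ | ⟨a, u⟩
    · simp [nil_mulHom, uncons_word]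
    · rcases v with _ | ⟨b, v⟩
      · simp [mulHom_nil, uncons_word]
      · rw [mulHom_word, wordMul_cons, map_add, uncons_consHom, uncons_consHom, uncons_word,
          uncons_word]
        by_cases hac : a = c <;> by_cases hbc : b = c <;>
          simp [hac, hbc, mulHom_word, add_comm]
  have h : (mulHom.compr₂ (uncons c) :
        ShuffleAlgebra k S →ₗ[k] ShuffleAlgebra k S →ₗ[k] ShuffleAlgebra k S)
      = mulHom.compl₂ (uncons c) + mulHom.comp (uncons c) :=
    hom_ext fun u => hom_ext fun v => by simpa using hw u v
  have := LinearMap.congr_fun (LinearMap.congr_fun h x) y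
  rw [mul_comm y]
  exact this

/-- Removing a first letter is a derivation for the shuffle product. -/
noncomputable def derivation (c : S) :
    Derivation k (ShuffleAlgebra k S) (ShuffleAlgebra k S) :=
  Derivation.mk' (uncons c) fun x y => by simpa using uncons_mul c x y

theorem coeff_nil_word_mul {u : List S} (hu : u ≠ []) (x : ShuffleAlgebra k S) :
    coeff [] (word k u * x) = 0 := by
  classical
  have h : (coeff []).comp (mulHom (word k u)) = (0 : ShuffleAlgebra k S →ₗ[k] k) := by
    refine hom_ext fun v => ?_
    rcases u with _ | ⟨a, u⟩
    · exact absurd rfl hu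
    · have key : ∀ (b : S) (y : ShuffleAlgebra k S), coeff [] (consHom b y) = (0 : k) := by
        intro b y
        have : (coeff []).comp (consHom b) = (0 : ShuffleAlgebra k S →ₗ[k] k) :=
          hom_ext fun w => by simp [coeff_word]
        exact LinearMap.congr_fun this y
      rcases v with _ | ⟨b, v⟩
      · simp [mulHom_nil, coeff_word]
      · simp [mulHom_word, wordMul_cons, key]
  exact LinearMap.congr_fun h x

/-- In characteristic `p` the `p`-th shuffle power of a nonempty word vanishes: its constant term
is zero, and so are all its derivatives, by `D (x ^ p) = p x ^ (p - 1) D x`. -/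
theorem word_pow_char_eq_zero (p : ℕ) [Fact p.Prime] [CharP k p] {w : List S} (hw : w ≠ []) :
    word k w ^ p = 0 := by
  refine ext_coeff fun s => ?_
  rcases s with _ | ⟨c, s⟩
  · obtain ⟨n, hn⟩ := Nat.exists_eq_succ_of_ne_zero (Fact.out : p.Prime).ne_zero
    rw [hn, pow_succ', coeff_nil_word_mul hw, map_zero]
  · have h := Derivation.leibniz_pow (derivation c) (word k w) p
    have h0 : uncons c (word k w ^ p) = 0 := by
      refine h.trans ?_
      rw [← Nat.cast_smul_eq_nsmul k, CharP.cast_eq_zero, zero_smul]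
    rw [← coeff_uncons, h0, map_zero, map_zero]

end Derivation

end ShuffleAlgebra

/-! ### Counting shuffles -/

section Count

variable {S : Type*} [DecidableEq S]

/-- The number of ways in which the word `s` is a shuffle of `u` and `v`, computed by deciding
from which of the two words each letter of `s` comes. -/
def shuffleCount : List S → List S → List S → ℕ
  | u, v, [] => if u = [] ∧ v = [] then 1 else 0
  | u, v, c :: s => (if u.head? = some c then shuffleCount u.tail v s else 0) +
      (if v.head? = some c then shuffleCount u v.tail s else 0)

theorem coeff_word_mul_word {k : Type*} [CommRing k] (u v s : List S) :
    ShuffleAlgebra.coeff s (ShuffleAlgebra.word k u * ShuffleAlgebra.word k v)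
      = (shuffleCount u v s : k) := by
  induction s generalizing u v with
  | nil =>
    rcases u with _ | ⟨a, u⟩
    · rw [← ShuffleAlgebra.one_def, one_mul, ShuffleAlgebra.coeff_word]
      simp [shuffleCount]
    · rw [ShuffleAlgebra.coeff_nil_word_mul (by simp)]
      simp [shuffleCount]
  | cons c s ih =>
    rw [← ShuffleAlgebra.coeff_uncons, ShuffleAlgebra.uncons_mul, ShuffleAlgebra.uncons_word,
      ShuffleAlgebra.uncons_word, shuffleCount, map_add, add_comm]
    push_cast
    congr 1
    · split_ifs
      · rw [mul_comm, ih]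
      · simp
    · split_ifs
      · rw [ih]
      · simp

theorem shuffleCount_comm (u v s : List S) : shuffleCount u v s = shuffleCount v u s := by
  induction s generalizing u v with
  | nil => simp [shuffleCount, and_comm]
  | cons c s ih => rw [shuffleCount, shuffleCount, add_comm, ih u v.tail, ih u.tail v]

theorem shuffleCount_nil_left (v s : List S) :
    shuffleCount [] v s = if v = s then 1 else 0 := by
  induction s generalizing v with
  | nil => simp [shuffleCount]
  | cons c s ih =>
    rcases v with _ | ⟨b, v⟩
    · simp [shuffleCount]
    · by_cases hbc : b = c <;> simp [shuffleCount, ih, hbc]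

theorem shuffleCount_nil_right (u s : List S) :
    shuffleCount u [] s = if u = s then 1 else 0 := by
  rw [shuffleCount_comm, shuffleCount_nil_left]

theorem shuffleCount_length {u v s : List S} (h : shuffleCount u v s ≠ 0) :
    s.length = u.length + v.length := by
  induction s generalizing u v with
  | nil =>
    simp only [shuffleCount, ne_eq, ite_eq_right_iff, not_forall] at h
    obtain ⟨⟨rfl, rfl⟩, -⟩ := h
    rfl
  | cons c s ih =>
    rw [shuffleCount] at h
    rcases u with _ | ⟨a, u⟩ <;> rcases v with _ | ⟨b, v⟩ <;>
      simp only [List.head?_nil, List.head?_cons, List.tail_cons, reduceCtorEq, if_false, add_zero,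
        zero_add, ne_eq, ite_eq_right_iff, not_forall, not_true_eq_false, Option.some.injEq] at h
    · obtain ⟨-, h⟩ := h
      simp [ih h]
    · obtain ⟨-, h⟩ := h
      simp [ih h]
    · by_cases h1 : shuffleCount u (b :: v) s = 0
      · have h2 : shuffleCount (a :: u) v s ≠ 0 := by
          intro h2
          simp [h1, h2] at h
        have := ih h2
        simp at this ⊢
        omega
      · have := ih h1
        simp at this ⊢
        omega

/-- A shuffle `s₁ ++ s₂` of `u` and `v` restricts to a shuffle `s₁` of prefixes of `u` and `v` and
to a shuffle `s₂` of the corresponding suffixes. Indices `i` beyond the length of `u` or `v` are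
harmless, since then the two prefixes are together too short for `s₁`. -/
theorem shuffleCount_append (u v s₁ s₂ : List S) :
    shuffleCount u v (s₁ ++ s₂) = ∑ i ∈ Finset.range (s₁.length + 1),
      shuffleCount (u.take i) (v.take (s₁.length - i)) s₁ *
        shuffleCount (u.drop i) (v.drop (s₁.length - i)) s₂ := by
  induction s₁ generalizing u v with
  | nil => simp [shuffleCount]
  | cons c s ih =>
    have hL : ∑ i ∈ Finset.range (s.length + 2),
        (if (u.take i).head? = some c then
            shuffleCount (u.take i).tail (v.take (s.length + 1 - i)) s else 0) *
          shuffleCount (u.drop i) (v.drop (s.length + 1 - i)) s₂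
        = if u.head? = some c then shuffleCount u.tail v (s ++ s₂) else 0 := by
      rw [Finset.sum_range_succ']
      rcases u with _ | ⟨a, u⟩
      · simp
      · by_cases hac : a = c <;> simp [hac, ih]
    have hR : ∑ i ∈ Finset.range (s.length + 2),
        (if (v.take (s.length + 1 - i)).head? = some c then
            shuffleCount (u.take i) (v.take (s.length + 1 - i)).tail s else 0) *
          shuffleCount (u.drop i) (v.drop (s.length + 1 - i)) s₂
        = if v.head? = some c then shuffleCount u v.tail (s ++ s₂) else 0 := by
      rw [Finset.sum_range_succ]
      rcases v with _ | ⟨b, v⟩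
      · simp
      · have : ∀ i ∈ Finset.range (s.length + 1), s.length + 1 - i = (s.length - i) + 1 := by
          intro i hi
          have := Finset.mem_range.1 hi
          omega
        rw [Finset.sum_congr rfl fun i hi => by rw [this i hi]]
        by_cases hbc : b = c <;> simp [hbc, ih]
    rw [List.cons_append, shuffleCount, ← hL, ← hR, ← Finset.sum_add_distrib]
    refine Finset.sum_congr rfl fun i _ => ?_
    rw [shuffleCount, List.length_cons, add_mul]

theorem exists_split_of_shuffleCount_ne_zero {u v s₁ s₂ : List S}
    (h : shuffleCount u v (s₁ ++ s₂) ≠ 0) :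
    ∃ u₁ u₂ v₁ v₂, u = u₁ ++ u₂ ∧ v = v₁ ++ v₂ ∧ shuffleCount u₁ v₁ s₁ ≠ 0 ∧
      shuffleCount u₂ v₂ s₂ ≠ 0 := by
  rw [shuffleCount_append] at h
  obtain ⟨i, -, hi⟩ := Finset.exists_ne_zero_of_sum_ne_zero h
  exact ⟨_, _, _, _, (List.take_append_drop i u).symm, (List.take_append_drop _ v).symm,
    left_ne_zero_of_mul hi, right_ne_zero_of_mul hi⟩

end Count

section Monotone

variable {S : Type*} [LinearOrder S]

theorem exists_shuffleCount_ne_zero (u v : List S) : ∃ s, shuffleCount u v s ≠ 0 := by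
  induction u with
  | nil => exact ⟨v, by simp [shuffleCount_nil_left]⟩
  | cons a u ih =>
    obtain ⟨s, hs⟩ := ih
    exact ⟨a :: s, by simp [shuffleCount, hs]⟩

/-- Interleaving along a fixed pattern is strictly monotone in each of the two words. -/
theorem exists_lt_shuffleCount_ne_zero {u v w s : List S} (h : shuffleCount u v s ≠ 0)
    (hlen : v.length = w.length) (hvw : v < w) : ∃ t, s < t ∧ shuffleCount u w t ≠ 0 := by
  induction s generalizing u v w with
  | nil =>
    have := shuffleCount_length h
    simp only [List.length_nil] at this
    have h0 : w = [] := List.eq_nil_of_length_eq_zero (by omega)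
    subst h0
    exact absurd hvw (List.not_lt_nil _)
  | cons c s ih =>
    rw [shuffleCount] at h
    by_cases h1 : (if u.head? = some c then shuffleCount u.tail v s else 0) = 0
    · rw [h1, zero_add] at h
      rcases v with _ | ⟨b, v⟩
      · simp at h
      rcases w with _ | ⟨d, w⟩
      · simp at hlen
      simp only [List.head?_cons, Option.some.injEq, List.tail_cons, ne_eq, ite_eq_right_iff,
        not_forall] at h
      obtain ⟨rfl, h⟩ := h
      rw [List.cons_lt_cons_iff] at hvw
      rcases hvw with hbd | ⟨rfl, hvw⟩
      · obtain ⟨t, ht⟩ := exists_shuffleCount_ne_zero u w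
        refine ⟨d :: t, List.cons_lt_cons_iff.2 (Or.inl hbd), ?_⟩
        simp [shuffleCount, ht]
      · obtain ⟨t, hst, ht⟩ := ih h (by simpa using hlen) hvw
        refine ⟨b :: t, List.cons_lt_cons_iff.2 (Or.inr ⟨rfl, hst⟩), ?_⟩
        simp [shuffleCount, ht]
    · simp only [ite_eq_right_iff, not_forall] at h1
      obtain ⟨hu, h1⟩ := h1
      obtain ⟨t, hst, ht⟩ := ih h1 hlen hvw
      refine ⟨c :: t, List.cons_lt_cons_iff.2 (Or.inr ⟨rfl, hst⟩), ?_⟩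
      simp [shuffleCount, hu, ht]

end Monotone

/-! ### Lexicographic order and Lyndon factorizations -/

theorem tensorPow_zero {S : Type*} (l : List S) : tensorPow l 0 = [] := rfl

theorem tensorPow_succ {S : Type*} (l : List S) (n : ℕ) :
    tensorPow l (n + 1) = l ++ tensorPow l n := by
  simp [tensorPow, List.replicate_succ]

section Lex

variable {S : Type*} [LinearOrder S]

theorem append_lt_append_iff_left {w u v : List S} : w ++ u < w ++ v ↔ u < v := by
  induction w with
  | nil => rfl
  | cons a w ih => simp [ih]

theorem lt_append_of_ne_nil (u : List S) {x : List S} (hx : x ≠ []) : u < u ++ x := by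
  have h : u ++ [] < u ++ x := by
    rw [append_lt_append_iff_left]
    rcases x with _ | ⟨a, x⟩
    · exact absurd rfl hx
    · exact List.nil_lt_cons a x
  rwa [List.append_nil] at h

theorem le_append_right_self (u x : List S) : u ≤ u ++ x := by
  by_cases hx : x = []
  · simp [hx]
  · exact (lt_append_of_ne_nil u hx).le

/-- A word `u < v` is either a proper prefix of `v`, or differs from `v` at some letter, in which
case the inequality does not depend on what follows the two words. -/
theorem prefix_or_append_lt_append {u v : List S} (h : u < v) :
    (∃ x, x ≠ [] ∧ v = u ++ x) ∨ ∀ x y, u ++ x < v ++ y := by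
  induction u generalizing v with
  | nil => exact Or.inl ⟨v, by rintro rfl; exact List.not_lt_nil _ h, rfl⟩
  | cons a u ih =>
    rcases v with _ | ⟨b, v⟩
    · exact absurd h (List.not_lt_nil _)
    · rcases List.cons_lt_cons_iff.1 h with hab | ⟨rfl, huv⟩
      · exact Or.inr fun x y => List.cons_lt_cons_iff.2 (Or.inl hab)
      · rcases ih huv with ⟨x, hx, rfl⟩ | h'
        · exact Or.inl ⟨x, hx, rfl⟩
        · exact Or.inr fun x y => List.cons_lt_cons_iff.2 (Or.inr ⟨rfl, h' x y⟩)

theorem append_lt_append_of_lt {u v : List S} (h : u < v) (hlen : v.length ≤ u.length)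
    (x y : List S) : u ++ x < v ++ y := by
  rcases prefix_or_append_lt_append h with ⟨z, hz, rfl⟩ | h'
  · have := List.length_pos_iff.2 hz
    simp only [List.length_append] at hlen
    omega
  · exact h' x y

theorem append_le_append_left {u v : List S} (w : List S) (h : u ≤ v) : w ++ u ≤ w ++ v := by
  rw [← not_lt] at h ⊢
  rwa [append_lt_append_iff_left]

theorem le_of_append_le_append {w u v : List S} (h : w ++ u ≤ w ++ v) : u ≤ v := by
  rw [← not_lt] at h ⊢
  rwa [append_lt_append_iff_left] at h

end Lex

section Lyndon

variable {S : Type*} [LinearOrder S]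

theorem IsLyndon.ne_nil {l : List S} (hl : IsLyndon l) : l ≠ [] := hl.1

theorem IsLyndon.lt_of_append {l u v : List S} (hl : IsLyndon l) (hu : u ≠ []) (hv : v ≠ [])
    (h : l = u ++ v) : l < v :=
  hl.2 u v hu hv h

theorem IsLyndon.le_of_append {l u v : List S} (hl : IsLyndon l) (hv : v ≠ [])
    (h : l = u ++ v) : l ≤ v := by
  by_cases hu : u = []
  · simp [h, hu]
  · exact (hl.lt_of_append hu hv h).le

theorem isLyndon_singleton (a : S) : IsLyndon [a] := by
  refine ⟨by simp, fun u v hu hv h => ?_⟩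
  have := congrArg List.length h
  have := List.length_pos_iff.2 hu
  have := List.length_pos_iff.2 hv
  simp only [List.length_append, List.length_singleton] at *
  omega

/-- The concatenation of two Lyndon words `u < v` is a Lyndon word. -/
theorem IsLyndon.append {u v : List S} (hu : IsLyndon u) (hv : IsLyndon v) (huv : u < v) :
    IsLyndon (u ++ v) := by
  have key : u ++ v < v := by
    rcases prefix_or_append_lt_append huv with ⟨x, hx, rfl⟩ | h
    · rw [append_lt_append_iff_left]
      exact hv.lt_of_append hu.ne_nil hx rfl
    · simpa using h v []
  refine ⟨by simp [hu.ne_nil], fun x y hx hy h => ?_⟩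
  rcases List.append_eq_append_iff.1 h with ⟨z, rfl, hz⟩ | ⟨z, hz, rfl⟩
  · exact key.trans_le (hv.le_of_append hy hz)
  · by_cases hz0 : z = []
    · simpa [hz0] using key
    · refine append_lt_append_of_lt (hu.lt_of_append hx hz0 hz) ?_ v v
      simp [hz]

/-- `PowBounded l w` says that the word `w` is at most the infinite periodic word `l l l ⋯`.
Since a prefix is smaller than the whole word, this means that `w` is at most some power of `l`. -/
def PowBounded (l w : List S) : Prop := ∃ n : ℕ, w ≤ tensorPow l n

theorem PowBounded.of_le {l w w' : List S} (h : PowBounded l w) (hw : w' ≤ w) :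
    PowBounded l w' :=
  h.imp fun _ hn => hw.trans hn

theorem PowBounded.left {l u v : List S} (h : PowBounded l (u ++ v)) : PowBounded l u :=
  h.of_le (le_append_right_self u v)

theorem PowBounded.take {l u : List S} (h : PowBounded l u) (i : ℕ) : PowBounded l (u.take i) :=
  PowBounded.left (v := u.drop i) (by rwa [List.take_append_drop])

theorem powBounded_nil (l : List S) : PowBounded l [] := ⟨0, le_rfl⟩

theorem tensorPow_le_succ (l : List S) (n : ℕ) : tensorPow l n ≤ tensorPow l (n + 1) := by
  induction n with
  | zero => rw [tensorPow_zero]; exact (le_append_right_self [] _)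
  | succ n ih =>
    rw [tensorPow_succ l n, tensorPow_succ l (n + 1)]
    exact append_le_append_left l ih

theorem PowBounded.exists_succ {l w : List S} (h : PowBounded l w) :
    ∃ n : ℕ, w ≤ tensorPow l (n + 1) :=
  h.imp fun n hn => hn.trans (tensorPow_le_succ l n)

theorem PowBounded.of_append {l w : List S} (h : PowBounded l (l ++ w)) : PowBounded l w := by
  obtain ⟨n, hn⟩ := h.exists_succ
  rw [tensorPow_succ] at hn
  exact ⟨n, le_of_append_le_append hn⟩

theorem powBounded_of_lt {l w : List S} (h : w < l) : PowBounded l w :=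
  ⟨1, by rw [tensorPow_succ, tensorPow_zero, List.append_nil]; exact h.le⟩

theorem PowBounded.append_self {l w : List S} (h : PowBounded l w) : PowBounded l (l ++ w) := by
  obtain ⟨n, hn⟩ := h
  exact ⟨n + 1, by rw [tensorPow_succ]; exact append_le_append_left l hn⟩

/-- For a Lyndon word `l`, the periodic word `l l l ⋯` is at most each of its shifts, so that
prefixing a word at most `l` preserves the bound. -/
theorem PowBounded.append_of_le {l m w : List S} (hl : IsLyndon l) (hm : m ≤ l)
    (h : PowBounded l w) : PowBounded l (m ++ w) := by
  rcases hm.eq_or_lt with rfl | hlt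
  · exact h.append_self
  rcases prefix_or_append_lt_append hlt with ⟨x, hx, rfl⟩ | hlt'
  -- Here `l = m ++ x`, and the suffix `x`, being shorter than `l`, exceeds `l` at some letter.
  · by_cases hm0 : m = []
    · simpa [hm0] using h
    obtain ⟨n, hn⟩ := h.exists_succ
    refine ⟨n + 2, ?_⟩
    rw [tensorPow_succ, List.append_assoc]
    refine append_le_append_left m (hn.trans ?_)
    rw [tensorPow_succ]
    rcases prefix_or_append_lt_append (hl.lt_of_append hm0 hx rfl) with ⟨y, hy, hxy⟩ | h'
    · have := congrArg List.length hxy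
      have := List.length_pos_iff.2 hy
      simp only [List.length_append] at *
      omega
    · exact (h' _ _).le
  · refine powBounded_of_lt ?_
    simpa using hlt' w []

theorem powBounded_flatten {l : List S} (hl : IsLyndon l) {A : List (List S)}
    (hA : ∀ m ∈ A, m ≤ l) : PowBounded l A.flatten := by
  induction A with
  | nil => exact powBounded_nil l
  | cons m A ih =>
    rw [List.flatten_cons]
    exact PowBounded.append_of_le hl (hA m (by simp)) (ih fun x hx => hA x (by simp [hx]))

/-- A Lyndon word greater than `l` exceeds the periodic word `l l l ⋯`. -/
theorem not_powBounded_of_lt {l m : List S} (hm : IsLyndon m) (h : l < m) : ¬ PowBounded l m := by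
  rintro ⟨n, hn⟩
  -- The induction on `n` cancels copies of `l`, so the bound is shown for all suffixes of `m`.
  suffices H : ∀ (n : ℕ) (y x : List S), x ≠ [] → m = y ++ x → tensorPow l n < x from
    absurd hn (not_le.2 (H n [] m hm.ne_nil rfl))
  clear n hn
  intro n
  induction n with
  | zero =>
    intro y x hx _
    rw [tensorPow_zero]
    rcases x with _ | ⟨a, x⟩
    · exact absurd rfl hx
    · exact List.nil_lt_cons a x
  | succ n ih =>
    intro y x hx hyx
    rw [tensorPow_succ]
    have hlx : l < x := h.trans_le (hm.le_of_append hx hyx)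
    rcases prefix_or_append_lt_append hlx with ⟨z, hz, rfl⟩ | h'
    · rw [append_lt_append_iff_left]
      exact ih (y ++ l) z hz (by simp [hyx])
    · simpa using h' (tensorPow l n) []

/-- A nonincreasing list of Lyndon words. -/
def IsLyndonList (A : List (List S)) : Prop := A.Pairwise (· ≥ ·) ∧ ∀ m ∈ A, IsLyndon m

theorem isLyndonList_cons {m : List S} {A : List (List S)} :
    IsLyndonList (m :: A) ↔ (∀ x ∈ A, x ≤ m) ∧ IsLyndon m ∧ IsLyndonList A := by
  simp only [IsLyndonList, List.pairwise_cons, List.mem_cons, forall_eq_or_imp]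
  tauto

theorem isLyndonList_nil : IsLyndonList ([] : List (List S)) := by simp [IsLyndonList]

theorem IsLyndonList.powBounded {m : List S} {A : List (List S)} (h : IsLyndonList (m :: A)) :
    PowBounded m (m :: A).flatten := by
  rw [isLyndonList_cons] at h
  exact powBounded_flatten h.2.1 (by simpa using h.1)

/-- A Lyndon word is put in front of a nonincreasing list of Lyndon words by merging it with the
first entries as long as they are larger. -/
theorem exists_isLyndonList_append {l : List S} (hl : IsLyndon l) {A : List (List S)}
    (hA : IsLyndonList A) : ∃ B, IsLyndonList B ∧ B.flatten = l ++ A.flatten := by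
  induction A generalizing l with
  | nil => exact ⟨[l], by simp [isLyndonList_cons, hl, isLyndonList_nil], by simp⟩
  | cons m A ih =>
    have hA' := isLyndonList_cons.1 hA
    rcases lt_or_ge l m with h | h
    · obtain ⟨B, hB, hBf⟩ := ih (hl.append hA'.2.1 h) hA'.2.2
      exact ⟨B, hB, by simp [hBf]⟩
    · refine ⟨l :: m :: A, isLyndonList_cons.2 ⟨?_, hl, hA⟩, by simp⟩
      simp only [List.mem_cons, forall_eq_or_imp]
      exact ⟨h, fun x hx => (hA'.1 x hx).trans h⟩

/-- Existence of the Chen–Fox–Lyndon factorization. -/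
theorem exists_isLyndonList_flatten (w : List S) : ∃ A, IsLyndonList A ∧ A.flatten = w := by
  induction w with
  | nil => exact ⟨[], isLyndonList_nil, rfl⟩
  | cons a w ih =>
    obtain ⟨A, hA, rfl⟩ := ih
    obtain ⟨B, hB, hBf⟩ := exists_isLyndonList_append (isLyndon_singleton a) hA
    exact ⟨B, hB, hBf⟩

/-- The first factor of a nonincreasing Lyndon factorization is the longest Lyndon prefix: a longer
Lyndon prefix would be larger than the first factor `a`, although the whole word is bounded by
`a a a ⋯`. -/
theorem IsLyndonList.length_le_of_prefix {a b x : List S} {A : List (List S)}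
    (hA : IsLyndonList (a :: A)) (hb : IsLyndon b) (h : (a :: A).flatten = b ++ x) :
    b.length ≤ a.length := by
  by_contra! hlt
  have hbA : PowBounded a b := (h ▸ hA.powBounded : PowBounded a (b ++ x)).left
  rw [List.flatten_cons] at h
  obtain ⟨z, rfl, -⟩ | ⟨z, rfl, -⟩ := List.append_eq_append_iff.1 h
  · refine not_powBounded_of_lt hb (lt_append_of_ne_nil a ?_) hbA
    rintro rfl
    simp at hlt
  · simp at hlt

/-- Uniqueness of the Chen–Fox–Lyndon factorization. -/
theorem IsLyndonList.eq_of_flatten_eq {A B : List (List S)} (hA : IsLyndonList A)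
    (hB : IsLyndonList B) (h : A.flatten = B.flatten) : A = B := by
  induction A generalizing B with
  | nil =>
    rcases B with _ | ⟨b, B⟩
    · rfl
    · have := (isLyndonList_cons.1 hB).2.1.ne_nil
      simp [this] at h
  | cons a A ih =>
    rcases B with _ | ⟨b, B⟩
    · have := (isLyndonList_cons.1 hA).2.1.ne_nil
      simp [this] at h
    · have hA' := isLyndonList_cons.1 hA
      have hB' := isLyndonList_cons.1 hB
      have hlen : a.length = b.length :=
        le_antisymm (hB.length_le_of_prefix hA'.2.1 (h.symm.trans List.flatten_cons))
          (hA.length_le_of_prefix hB'.2.1 (h.trans List.flatten_cons))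
      rw [List.flatten_cons, List.flatten_cons] at h
      obtain ⟨rfl, h'⟩ := List.append_inj h hlen
      rw [ih hA'.2.2 hB'.2.2 h']

end Lyndon

/-! ### The largest shuffle of products of Lyndon words -/

section LargestShuffle

variable {S : Type*} [LinearOrder S]

theorem PowBounded.le_dropLast {l u : List S} (h : PowBounded l u) (hlen : u.length < l.length) :
    u ≤ l.dropLast := by
  by_contra! hlt
  obtain ⟨n, hn⟩ := h.exists_succ
  have hl : l ≠ [] := by
    rintro rfl
    simp at hlen
  have hlen' : u.length ≤ l.dropLast.length := by
    rw [List.length_dropLast]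
    omega
  have := append_lt_append_of_lt hlt hlen' ([l.getLast hl] ++ tensorPow l n) []
  rw [← List.append_assoc, List.dropLast_append_getLast, List.append_nil, ← tensorPow_succ] at this
  exact absurd hn (not_le.2 this)

theorem PowBounded.le_of_length_eq {l u : List S} (h : PowBounded l u)
    (hlen : u.length = l.length) : u ≤ l := by
  by_contra! hlt
  obtain ⟨n, hn⟩ := h.exists_succ
  have := append_lt_append_of_lt hlt hlen.le (tensorPow l n) []
  rw [← tensorPow_succ, List.append_nil] at this
  exact absurd hn (not_le.2 this)

theorem IsLyndon.length_pos {l : List S} (hl : IsLyndon l) : 0 < l.length :=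
  List.length_pos_iff.2 hl.ne_nil

/-- Two words that are shorter than the Lyndon word `l` and bounded by `l l l ⋯` are bounded by
`a a a ⋯`, where `a` is the first Lyndon factor of `l` with its last letter removed. If that bound
passes to shuffles, then all shuffles of the two words are smaller than `l`. -/
theorem shuffle_lt_of_forall_shorter {l : List S} (hl : IsLyndon l)
    (IH : ∀ a : List S, a.length < l.length → IsLyndon a → ∀ u v s : List S,
      PowBounded a u → PowBounded a v → shuffleCount u v s ≠ 0 → PowBounded a s)
    {u v s : List S} (hu : PowBounded l u) (hv : PowBounded l v) (hul : u.length < l.length)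
    (hvl : v.length < l.length) (h : shuffleCount u v s ≠ 0) : s < l := by
  obtain ⟨A, hA, hAl⟩ := exists_isLyndonList_flatten l.dropLast
  have hpos := hl.length_pos
  rcases A with _ | ⟨a, A⟩
  · have h0 : l.dropLast.length = 0 := by rw [← hAl]; rfl
    rw [List.length_dropLast] at h0
    have hs := shuffleCount_length h
    have : s = [] := List.eq_nil_of_length_eq_zero (by omega)
    subst this
    simpa using lt_append_of_ne_nil [] hl.ne_nil
  · have hbound : PowBounded a l.dropLast := hAl ▸ hA.powBounded
    have hlast : l = a ++ (A.flatten ++ [l.getLast hl.ne_nil]) := by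
      rw [← List.append_assoc, ← List.flatten_cons, hAl, List.dropLast_append_getLast]
    have hal : a < l := (lt_append_of_ne_nil a (by simp)).trans_eq hlast.symm
    have hlen : a.length < l.length := by
      have := congrArg List.length hlast
      simp only [List.length_append, List.length_singleton] at this
      omega
    have hs := IH a hlen (isLyndonList_cons.1 hA).2.1 u v s (hbound.of_le (hu.le_dropLast hul))
      (hbound.of_le (hv.le_dropLast hvl)) h
    by_contra! hle
    exact not_powBounded_of_lt hl hal (hs.of_le hle)

/-- The first block of length `|l|` in a shuffle of two words bounded by `l l l ⋯` either is smaller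
than `l`, or equals `l` and then comes entirely from one of the two words. -/
theorem shuffle_block {l : List S}
    (hshort : ∀ u v s : List S, PowBounded l u → PowBounded l v → u.length < l.length →
      v.length < l.length → shuffleCount u v s ≠ 0 → s < l)
    {u v s₁ s₂ : List S} (hu : PowBounded l u) (hv : PowBounded l v)
    (hs₁ : s₁.length = l.length) (h : shuffleCount u v (s₁ ++ s₂) ≠ 0) :
    s₁ < l ∨ s₁ = l ∧ ((∃ u', u = l ++ u' ∧ shuffleCount u' v s₂ ≠ 0) ∨
      ∃ v', v = l ++ v' ∧ shuffleCount u v' s₂ ≠ 0) := by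
  obtain ⟨u₁, u₂, v₁, v₂, rfl, rfl, h₁, h₂⟩ := exists_split_of_shuffleCount_ne_zero h
  have hlen := shuffleCount_length h₁
  by_cases hv0 : v₁ = []
  · subst hv0
    rw [shuffleCount_nil_right] at h₁
    obtain rfl : u₁ = s₁ := by simpa using h₁
    rcases (hu.left.le_of_length_eq hs₁).lt_or_eq with hlt | rfl
    · exact Or.inl hlt
    · exact Or.inr ⟨rfl, Or.inl ⟨u₂, rfl, by simpa using h₂⟩⟩
  by_cases hu0 : u₁ = []
  · subst hu0
    rw [shuffleCount_nil_left] at h₁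
    obtain rfl : v₁ = s₁ := by simpa using h₁
    rcases (hv.left.le_of_length_eq hs₁).lt_or_eq with hlt | rfl
    · exact Or.inl hlt
    · exact Or.inr ⟨rfl, Or.inr ⟨v₂, rfl, by simpa using h₂⟩⟩
  · have := List.length_pos_iff.2 hu0
    have := List.length_pos_iff.2 hv0
    exact Or.inl (hshort u₁ v₁ s₁ hu.left hv.left (by omega) (by omega) h₁)

/-- Being bounded by `l l l ⋯`, for a Lyndon word `l`, passes to shuffles. -/
theorem PowBounded.shuffle {l : List S} (hl : IsLyndon l) {u v s : List S} (hu : PowBounded l u)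
    (hv : PowBounded l v) (h : shuffleCount u v s ≠ 0) : PowBounded l s := by
  induction hn : l.length using Nat.strong_induction_on generalizing l u v s with
  | _ n IH =>
  have hshort : ∀ u v s : List S, PowBounded l u → PowBounded l v → u.length < l.length →
      v.length < l.length → shuffleCount u v s ≠ 0 → s < l :=
    fun u v s hu hv hul hvl h => shuffle_lt_of_forall_shorter hl
      (fun a ha hla u v s hu hv h => IH a.length (hn ▸ ha) hla hu hv h rfl) hu hv hul hvl h
  clear IH
  induction hk : s.length using Nat.strong_induction_on generalizing u v s with
  | _ k IH =>
  by_cases hcase : u.length < l.length ∧ v.length < l.length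
  · exact powBounded_of_lt (hshort u v s hu hv hcase.1 hcase.2 h)
  have hlen := shuffleCount_length h
  have hpos := hl.length_pos
  have hs : s.take l.length ++ s.drop l.length = s := List.take_append_drop _ _
  have htake : (s.take l.length).length = l.length := by
    rw [List.length_take]
    omega
  have hdrop : (s.drop l.length).length < k := by
    rw [List.length_drop]
    omega
  rw [← hs] at h ⊢
  rcases shuffle_block hshort hu hv htake h with hlt | ⟨heq, ⟨u', rfl, h'⟩ | ⟨v', rfl, h'⟩⟩
  · refine powBounded_of_lt ?_
    simpa using append_lt_append_of_lt hlt htake.ge (s.drop l.length) []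
  · rw [heq]
    exact (IH _ hdrop hu.of_append hv h' rfl).append_self
  · rw [heq]
    exact (IH _ hdrop hu hv.of_append h' rfl).append_self

theorem shuffle_lt_of_shorter {l : List S} (hl : IsLyndon l) {u v s : List S}
    (hu : PowBounded l u) (hv : PowBounded l v) (hul : u.length < l.length)
    (hvl : v.length < l.length) (h : shuffleCount u v s ≠ 0) : s < l :=
  shuffle_lt_of_forall_shorter hl (fun _ _ ha _ _ _ hu hv h => hu.shuffle ha hv h) hu hv hul hvl h

/-- Shuffles of two words bounded by `l l l ⋯` that start with the Lyndon word `l` arise by taking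
the block `l` from one of the two words. -/
theorem shuffleCount_lyndon_append {l : List S} (hl : IsLyndon l) {u v : List S}
    (hu : PowBounded l u) (hv : PowBounded l v) (s : List S) :
    shuffleCount u v (l ++ s) = (if l <+: u then shuffleCount (u.drop l.length) v s else 0) +
      (if l <+: v then shuffleCount u (v.drop l.length) s else 0) := by
  obtain ⟨n, hn⟩ := Nat.exists_eq_succ_of_ne_zero hl.length_pos.ne'
  rw [shuffleCount_append, hn, Finset.sum_range_succ, Finset.sum_range_succ', Finset.sum_eq_zero]
  · simp only [Nat.succ_eq_add_one, List.take_zero, List.drop_zero, Nat.sub_zero, Nat.sub_self,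
      shuffleCount_nil_left, shuffleCount_nil_right, List.prefix_iff_eq_take, hn, ite_mul, one_mul,
      zero_mul, zero_add, eq_comm (a := l)]
    rw [add_comm]
  -- If both words contribute to the first block, that block is smaller than `l`.
  · intro i hi
    rw [Finset.mem_range] at hi
    have h0 : shuffleCount (u.take (i + 1)) (v.take (n.succ - (i + 1))) l = 0 := by
      by_contra h
      refine lt_irrefl l (shuffle_lt_of_shorter hl (hu.take _) (hv.take _) ?_ ?_ h) <;>
        rw [List.length_take] <;> omega
    rw [h0, zero_mul]

/-- A nonincreasing product of Lyndon words that are at most `m` starts with `m` only if its first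
factor is `m`. -/
theorem IsLyndonList.exists_cons_of_flatten_eq {m u : List S} {A : List (List S)}
    (hm : IsLyndon m) (hA : IsLyndonList A) (hAm : ∀ x ∈ A, x ≤ m) (h : A.flatten = m ++ u) :
    ∃ A', A = m :: A' ∧ u = A'.flatten := by
  rcases A with _ | ⟨a, A⟩
  · simp [hm.ne_nil] at h
  · obtain rfl : a = m := by
      by_contra hne
      have hlt : a < m := lt_of_le_of_ne (hAm a (by simp)) hne
      exact not_powBounded_of_lt hm hlt (h ▸ hA.powBounded : PowBounded a (m ++ u)).left
    rw [List.flatten_cons, List.append_cancel_left_eq] at h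
    exact ⟨A, rfl, h.symm⟩

/-- The largest shuffle of two nonincreasing products of Lyndon words is the nonincreasing product
of all factors of both. -/
theorem shuffle_le_flatten {A B C : List (List S)} (hA : IsLyndonList A) (hB : IsLyndonList B)
    (hC : IsLyndonList C) (hperm : (A ++ B).Perm C) {s : List S}
    (h : shuffleCount A.flatten B.flatten s ≠ 0) : s ≤ C.flatten := by
  induction C generalizing A B s with
  | nil =>
    obtain ⟨rfl, rfl⟩ := List.append_eq_nil_iff.1 hperm.eq_nil
    rw [List.flatten_nil, shuffleCount_nil_left] at h
    obtain rfl : [] = s := by simpa using h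
    exact le_rfl
  | cons m C ih =>
    obtain ⟨hCm, hm, hC'⟩ := isLyndonList_cons.1 hC
    have hle : ∀ x ∈ A ++ B, x ≤ m := by
      intro x hx
      rcases List.mem_cons.1 (hperm.subset hx) with rfl | hx
      · exact le_rfl
      · exact hCm x hx
    have hAm : ∀ x ∈ A, x ≤ m := fun x hx => hle x (List.mem_append_left _ hx)
    have hBm : ∀ x ∈ B, x ≤ m := fun x hx => hle x (List.mem_append_right _ hx)
    have hlen : m.length ≤ s.length := by
      have h1 := hperm.flatten.length_eq
      have h2 := shuffleCount_length h
      simp only [List.flatten_append, List.length_append, List.flatten_cons] at h1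
      omega
    have hs : s.take m.length ++ s.drop m.length = s := List.take_append_drop _ _
    have htake : (s.take m.length).length = m.length := by simpa using hlen
    rw [← hs] at h ⊢
    rw [List.flatten_cons]
    rcases shuffle_block (fun u v s hu hv => shuffle_lt_of_shorter hm hu hv)
      (powBounded_flatten hm hAm) (powBounded_flatten hm hBm) htake h with
      hlt | ⟨heq, ⟨u', hu', h'⟩ | ⟨v', hv', h'⟩⟩
    · exact (append_lt_append_of_lt hlt htake.ge _ _).le
    · obtain ⟨A', rfl, rfl⟩ := hA.exists_cons_of_flatten_eq hm hAm hu'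
      rw [heq]
      exact append_le_append_left m
        (ih (isLyndonList_cons.1 hA).2.2 hB hC' ((List.perm_cons m).1 hperm) h')
    · obtain ⟨B', rfl, rfl⟩ := hB.exists_cons_of_flatten_eq hm hBm hv'
      rw [heq]
      exact append_le_append_left m (ih hA (isLyndonList_cons.1 hB).2.2 hC'
        ((List.perm_cons m).1 (List.perm_middle.symm.trans hperm)) h')

theorem isLyndonList_replicate {l : List S} (hl : IsLyndon l) (n : ℕ) :
    IsLyndonList (List.replicate n l) :=
  ⟨List.pairwise_replicate.2 (Or.inr le_rfl), fun _ hm => (List.eq_of_mem_replicate hm) ▸ hl⟩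

theorem IsLyndonList.eq_of_perm {A B : List (List S)} (hA : IsLyndonList A) (hB : IsLyndonList B)
    (h : A.Perm B) : A = B :=
  h.eq_of_pairwise (fun _ _ _ _ h₁ h₂ => le_antisymm h₂ h₁) hA.1 hB.1

/-- The multiplicity of the largest shuffle of `l ⊗ ⋯ ⊗ l` with a nonincreasing product of Lyndon
words is a binomial coefficient, by Pascal's rule. -/
theorem shuffleCount_tensorPow_flatten {l : List S} (hl : IsLyndon l) (a : ℕ)
    {B C : List (List S)} (hB : IsLyndonList B) (hC : IsLyndonList C)
    (hperm : (List.replicate a l ++ B).Perm C) :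
    shuffleCount (tensorPow l a) B.flatten C.flatten =
      (a + Multiset.count l (B : Multiset (List S))).choose a := by
  induction C generalizing a B with
  | nil =>
    obtain ⟨h0, rfl⟩ := List.append_eq_nil_iff.1 hperm.eq_nil
    obtain rfl : a = 0 := by simpa using h0
    simp [tensorPow_zero, shuffleCount]
  | cons m C ih =>
    rcases a with _ | a
    · rw [List.replicate_zero, List.nil_append] at hperm
      rw [hB.eq_of_perm hC hperm]
      simp [tensorPow_zero, shuffleCount_nil_left]
    obtain ⟨hCm, hm, hC'⟩ := isLyndonList_cons.1 hC
    have hle : ∀ x ∈ List.replicate (a + 1) l ++ B, x ≤ m := by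
      intro x hx
      rcases List.mem_cons.1 (hperm.subset hx) with rfl | hx
      · exact le_rfl
      · exact hCm x hx
    have hAm : ∀ x ∈ List.replicate (a + 1) l, x ≤ m :=
      fun x hx => hle x (List.mem_append_left _ hx)
    have hBm : ∀ x ∈ B, x ≤ m := fun x hx => hle x (List.mem_append_right _ hx)
    have hA := isLyndonList_replicate hl (a + 1)
    have hlm : l ≤ m := hAm l (by simp)
    have hhead : m ∈ B → ∃ B', B = m :: B' := by
      intro hmB
      rcases B with _ | ⟨b, B'⟩
      · simp at hmB
      · have hbm : m ≤ b := by
          rcases List.mem_cons.1 hmB with rfl | h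
          · exact le_rfl
          · exact (isLyndonList_cons.1 hB).1 m h
        exact ⟨B', by rw [le_antisymm hbm (hBm b (by simp))]⟩
    have hAb : PowBounded m (tensorPow l (a + 1)) := powBounded_flatten hm hAm
    rw [List.flatten_cons, shuffleCount_lyndon_append hm hAb (powBounded_flatten hm hBm)]
    have hBstep : ∀ B', B = m :: B' →
        (if m <+: B.flatten then
          shuffleCount (tensorPow l (a + 1)) (B.flatten.drop m.length) C.flatten else 0)
          = (a + 1 + Multiset.count l (B' : Multiset (List S))).choose (a + 1) := by
      rintro B' rfl
      rw [if_pos (by simp), List.flatten_cons, List.drop_left]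
      exact ih (a + 1) (isLyndonList_cons.1 hB).2.2 hC'
        ((List.perm_cons m).1 (List.perm_middle.symm.trans hperm))
    rcases hlm.eq_or_lt with rfl | hlt
    · rw [if_pos (by rw [tensorPow_succ]; simp), tensorPow_succ, List.drop_left,
        ih a hB hC' ((List.perm_cons l).1 hperm), ← tensorPow_succ]
      by_cases hlB : l ∈ B
      · obtain ⟨B', rfl⟩ := hhead hlB
        rw [hBstep B' rfl, ← Multiset.cons_coe, Multiset.count_cons_self]
        generalize Multiset.count l (B' : Multiset (List S)) = b
        rw [show a + 1 + b = a + (b + 1) by omega, show a + 1 + (b + 1) = a + (b + 1) + 1 by omega,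
          Nat.choose_succ_succ]
      · rw [if_neg, Multiset.count_eq_zero_of_notMem (by simpa using hlB)]
        · simp
        · rintro ⟨u, hu⟩
          obtain ⟨B', rfl, -⟩ := hB.exists_cons_of_flatten_eq hm hBm hu.symm
          simp at hlB
    · have hmB : m ∈ B := by
        rcases List.mem_append.1 (hperm.symm.subset (List.mem_cons_self (a := m) (l := C)))
          with h | h
        · exact absurd (List.eq_of_mem_replicate h) hlt.ne'
        · exact h
      obtain ⟨B', rfl⟩ := hhead hmB
      rw [hBstep B' rfl, if_neg, ← Multiset.cons_coe, Multiset.count_cons_of_ne hlt.ne, zero_add]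
      rintro ⟨u, hu⟩
      obtain ⟨A', hA', -⟩ := hA.exists_cons_of_flatten_eq hm hAm hu.symm
      rw [List.replicate_succ, List.cons.injEq] at hA'
      exact hlt.ne hA'.1

end LargestShuffle

/-! ### Leading terms in the shuffle algebra -/

section LeadingTerm

namespace ShuffleAlgebra

section Expansion

variable {k : Type*} [CommRing k] {S : Type*}

theorem liftWords_apply {M : Type*} [AddCommGroup M] [Module k M] (g : List S → M)
    (f : ShuffleAlgebra k S) :
    liftWords g f = ∑ x ∈ Finsupp.support (M := k) f, coeff x f • g x :=
  Finsupp.linearCombination_apply k f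

theorem mem_support_iff {f : ShuffleAlgebra k S} {x : List S} :
    x ∈ Finsupp.support (M := k) f ↔ coeff x f ≠ 0 :=
  Finsupp.mem_support_iff

theorem eq_sum_coeff_smul_word (f : ShuffleAlgebra k S) :
    f = ∑ x ∈ Finsupp.support (M := k) f, coeff x f • word k x := by
  rw [← liftWords_apply]
  have h : (liftWords (word k) : ShuffleAlgebra k S →ₗ[k] _) = LinearMap.id :=
    hom_ext fun w => by simp
  rw [h, LinearMap.id_apply]

end Expansion

variable {S : Type*} [LinearOrder S]

section CommRing

variable {k : Type*} [CommRing k]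

/-- `HasLeadingTerm f c w` says that `f` is `c` times the word `w` plus a combination of smaller
words of the same length. -/
def HasLeadingTerm (f : ShuffleAlgebra k S) (c : k) (w : List S) : Prop :=
  coeff w f = c ∧ ∀ s, coeff s f ≠ 0 → s.length = w.length ∧ s ≤ w

theorem coeff_word_mul (u s : List S) (f : ShuffleAlgebra k S) :
    coeff s (word k u * f)
      = ∑ x ∈ Finsupp.support (M := k) f, coeff x f * (shuffleCount u x s : k) := by
  have h : (coeff s).comp (mulHom (word k u)) = liftWords fun x => (shuffleCount u x s : k) :=
    hom_ext fun v => by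
      rw [liftWords_word, ← coeff_word_mul_word]
      rfl
  refine (LinearMap.congr_fun h f).trans ?_
  simp only [liftWords_apply, smul_eq_mul]

theorem hasLeadingTerm_one : HasLeadingTerm (1 : ShuffleAlgebra k S) 1 [] := by
  refine ⟨by simp [one_def, coeff_word], fun s hs => ?_⟩
  rw [one_def, coeff_word] at hs
  obtain rfl : [] = s := by
    by_contra h
    simp [h] at hs
  exact ⟨rfl, le_rfl⟩

/-- If `m` is the largest shuffle of `u` and `w`, then multiplication by `u` turns the leading word
`w` into `m`, because the shuffles of `u` with a smaller word are smaller than `m`. -/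
theorem HasLeadingTerm.word_mul {f : ShuffleAlgebra k S} {c : k} {w u m : List S}
    (hf : HasLeadingTerm f c w) (hmax : ∀ s, shuffleCount u w s ≠ 0 → s ≤ m)
    (hm : shuffleCount u w m ≠ 0) :
    HasLeadingTerm (word k u * f) (c * (shuffleCount u w m : k)) m := by
  have hle : ∀ x s, coeff x f ≠ 0 → shuffleCount u x s ≠ 0 → s ≤ m ∧ (x ≠ w → s < m) := by
    intro x s hx hs
    obtain ⟨hlen, hxw⟩ := hf.2 x hx
    rcases hxw.eq_or_lt with rfl | hlt
    · exact ⟨hmax s hs, fun h => absurd rfl h⟩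
    · obtain ⟨t, hst, ht⟩ := exists_lt_shuffleCount_ne_zero hs hlen hlt
      have := hst.trans_le (hmax t ht)
      exact ⟨this.le, fun _ => this⟩
  constructor
  · rw [coeff_word_mul, Finset.sum_eq_single w, hf.1]
    · intro x hx hxw
      have : shuffleCount u x m = 0 := by
        by_contra h
        exact lt_irrefl m ((hle x m (mem_support_iff.1 hx) h).2 hxw)
      rw [this, Nat.cast_zero, mul_zero]
    · intro hw
      rw [mem_support_iff, not_not] at hw
      rw [hw, zero_mul]
  · intro s hs
    rw [coeff_word_mul] at hs
    obtain ⟨x, -, hx⟩ := Finset.exists_ne_zero_of_sum_ne_zero hs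
    have hxf := left_ne_zero_of_mul hx
    have hxs : shuffleCount u x s ≠ 0 := by
      intro h
      simp [h] at hx
    refine ⟨?_, (hle x s hxf hxs).1⟩
    rw [shuffleCount_length hxs, shuffleCount_length hm, (hf.2 x hxf).1]

end CommRing

section Field

variable {k : Type*} [Field k]

/-- Elements with distinct leading words are linearly independent. -/
theorem eq_zero_of_sum_smul_eq_zero {ι : Type*} {s : Finset ι} {f : ι → ShuffleAlgebra k S}
    {c : ι → k} {w : ι → List S} (hf : ∀ i ∈ s, HasLeadingTerm (f i) (c i) (w i))
    (hc : ∀ i ∈ s, c i ≠ 0) (hw : Set.InjOn w s) {g : ι → k} (h : ∑ i ∈ s, g i • f i = 0) :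
    ∀ i ∈ s, g i = 0 := by
  classical
  by_contra! hne
  obtain ⟨i₀, hi₀, hgi₀⟩ := hne
  obtain ⟨i, hi, hmax⟩ := Finset.exists_max_image (s.filter fun i => g i ≠ 0) w
    ⟨i₀, Finset.mem_filter.2 ⟨hi₀, hgi₀⟩⟩
  obtain ⟨his, hgi⟩ := Finset.mem_filter.1 hi
  have h1 := congrArg (coeff (w i)) h
  rw [map_sum, Finset.sum_eq_single i, map_smul, map_zero, (hf i his).1, smul_eq_mul] at h1
  · exact mul_ne_zero hgi (hc i his) h1
  · intro j hj hji
    rw [map_smul, smul_eq_mul]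
    by_contra hne
    have hle := ((hf j hj).2 _ (right_ne_zero_of_mul hne)).2
    have hge := hmax j (Finset.mem_filter.2 ⟨hj, left_ne_zero_of_mul hne⟩)
    exact hji (hw hj his (le_antisymm hge hle))
  · exact fun h => absurd his h

/-- A subspace that contains an element with leading word `w`, for every word `w`, is everything:
there are only finitely many words of a given length. -/
theorem submodule_eq_top_of_hasLeadingTerm [Finite S] (R : Submodule k (ShuffleAlgebra k S))
    (h : ∀ w, ∃ f ∈ R, ∃ c ≠ 0, HasLeadingTerm f c w) : R = ⊤ := by
  classical
  -- Words of length `n` are treated by induction along the lexicographic order.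
  have key : ∀ (n : ℕ) (w : {w : List S // w.length = n}), word k w.1 ∈ R := by
    intro n w
    have : Finite {w : List S // w.length = n} := List.finite_length_eq S n
    induction w using WellFoundedLT.induction with
    | _ w ih =>
    obtain ⟨f, hfR, c, hc, hf⟩ := h w.1
    have hmem : w.1 ∈ Finsupp.support (M := k) f := by
      rw [mem_support_iff, hf.1]
      exact hc
    have hsum := eq_sum_coeff_smul_word f
    rw [← Finset.add_sum_erase _ _ hmem, hf.1] at hsum
    have hcw : c • word k w.1 ∈ R := by
      rw [eq_sub_of_add_eq hsum.symm]
      refine R.sub_mem hfR (R.sum_mem fun x hx => R.smul_mem _ ?_)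
      obtain ⟨hxw, hx⟩ := Finset.mem_erase.1 hx
      obtain ⟨hlen, hle⟩ := hf.2 x (mem_support_iff.1 hx)
      exact ih ⟨x, hlen.trans w.2⟩ (lt_of_le_of_ne hle fun h => hxw (congrArg Subtype.val h))
    exact (R.smul_mem_iff hc).1 hcw
  rw [eq_top_iff]
  intro f _
  rw [eq_sum_coeff_smul_word f]
  exact R.sum_mem fun x _ => R.smul_mem _ (key _ ⟨x, rfl⟩)

end Field

end ShuffleAlgebra

end LeadingTerm

/-! ### Base `p` digits and binomial coefficients -/

section Digits

variable {p : ℕ}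

theorem sum_digits_div_mod {d : ℕ → ℕ} (hd : ∀ i, d i < p) {j K : ℕ} (hj : j < K) :
    (∑ i ∈ Finset.range K, d i * p ^ i) / p ^ j % p = d j := by
  have hp : 0 < p := (Nat.zero_le _).trans_lt (hd 0)
  induction j generalizing d K with
  | zero =>
    obtain ⟨K, rfl⟩ := Nat.exists_eq_succ_of_ne_zero hj.ne'
    rw [Finset.sum_range_succ', pow_zero, Nat.div_one, mul_one, Nat.add_mod]
    have : (∑ i ∈ Finset.range K, d (i + 1) * p ^ (i + 1)) % p = 0 := by
      refine Nat.mod_eq_zero_of_dvd (Finset.dvd_sum fun i _ => ?_)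
      exact Dvd.dvd.mul_left (dvd_pow_self p (Nat.succ_ne_zero i)) _
    rw [this, zero_add, Nat.mod_mod, Nat.mod_eq_of_lt (hd 0)]
  | succ j ih =>
    obtain ⟨K, rfl⟩ := Nat.exists_eq_succ_of_ne_zero (Nat.zero_lt_of_lt hj).ne'
    rw [Finset.sum_range_succ', pow_zero, mul_one, pow_succ', ← Nat.div_div_eq_div_mul]
    have : ∑ i ∈ Finset.range K, d (i + 1) * p ^ (i + 1)
        = p * ∑ i ∈ Finset.range K, d (i + 1) * p ^ i := by
      rw [Finset.mul_sum]
      exact Finset.sum_congr rfl fun i _ => by ring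
    rw [this, Nat.mul_add_div hp, Nat.div_eq_of_lt (hd 0), add_zero]
    exact ih (fun i => hd (i + 1)) (Nat.lt_of_succ_lt_succ hj)

/-- If the `j`-th base `p` digit of `n` is less than `p - 1`, then adding `p ^ j` to `n` produces
no carry, so the binomial coefficient is prime to `p`. -/
theorem not_dvd_choose_pow_add [Fact p.Prime] (j n : ℕ) (h : n / p ^ j % p + 1 < p) :
    ¬ p ∣ (p ^ j + n).choose (p ^ j) := by
  have hp : p.Prime := Fact.out
  induction j generalizing n with
  | zero =>
    rw [pow_zero, Nat.div_one] at h
    rw [pow_zero, Nat.choose_one_right, Nat.dvd_iff_mod_eq_zero, Nat.add_mod,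
      Nat.mod_eq_of_lt hp.one_lt, add_comm, Nat.mod_eq_of_lt h]
    exact Nat.succ_ne_zero _
  | succ j ih =>
    rw [(Choose.choose_modEq_choose_mod_mul_choose_div_nat (p := p)).dvd_iff dvd_rfl,
      Nat.mod_eq_zero_of_dvd (dvd_pow_self p (Nat.succ_ne_zero j)), Nat.choose_zero_right,
      one_mul, pow_succ', Nat.mul_add_div hp.pos, Nat.mul_div_cancel_left _ hp.pos]
    refine ih (n / p) ?_
    rwa [Nat.div_div_eq_div_mul, ← pow_succ']

end Digits

/-! ### Lyndon factors of products of words in `TL` -/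

section Factors

variable {S : Type*} [LinearOrder S]

/-- The nonincreasing list of the Lyndon factors of a word. -/
noncomputable def lyndonFactors (w : List S) : List (List S) :=
  (exists_isLyndonList_flatten w).choose

theorem lyndonFactors_flatten {A : List (List S)} (hA : IsLyndonList A) :
    lyndonFactors A.flatten = A :=
  (exists_isLyndonList_flatten A.flatten).choose_spec.1.eq_of_flatten_eq hA
    (exists_isLyndonList_flatten A.flatten).choose_spec.2

theorem isLyndonList_lyndonFactors (w : List S) : IsLyndonList (lyndonFactors w) :=
  (exists_isLyndonList_flatten w).choose_spec.1

variable {p : ℕ}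

/-- The element `l^{⊗ p ^ j}` of `TL`. -/
def TL.mk {l : List S} (hl : IsLyndon l) (j : ℕ) : TL p S :=
  ⟨tensorPow l (p ^ j), l, hl, j, rfl⟩

theorem TL.exists_eq_mk (w : TL p S) :
    ∃ (l : List S) (hl : IsLyndon l) (j : ℕ), w = TL.mk hl j := by
  obtain ⟨w, l, hl, j, rfl⟩ := w
  exact ⟨l, hl, j, rfl⟩

theorem TL.lyndonFactors_mk {l : List S} (hl : IsLyndon l) (j : ℕ) :
    lyndonFactors (TL.mk hl j : TL p S).1 = List.replicate (p ^ j) l :=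
  lyndonFactors_flatten (isLyndonList_replicate hl (p ^ j))

theorem TL.mk_eq_mk_iff [Fact p.Prime] {l m : List S} (hl : IsLyndon l) (hm : IsLyndon m)
    (i j : ℕ) : (TL.mk hl i : TL p S) = TL.mk hm j ↔ l = m ∧ i = j := by
  have hp : p.Prime := Fact.out
  refine ⟨fun h => ?_, ?_⟩
  · have h' := congrArg (fun w : TL p S => lyndonFactors w.1) h
    simp only [TL.lyndonFactors_mk] at h'
    have hij : i = j := Nat.pow_right_injective hp.two_le (by simpa using congrArg List.length h')
    subst hij
    exact ⟨(List.replicate_right_inj (pow_pos hp.pos i).ne').1 h', rfl⟩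
  · rintro ⟨rfl, rfl⟩
    rfl

theorem TL.ne_nil [Fact p.Prime] (w : TL p S) : w.1 ≠ [] := by
  obtain ⟨l, hl, j, rfl⟩ := TL.exists_eq_mk w
  intro h
  have h1 := TL.lyndonFactors_mk (p := p) hl j
  have h2 := lyndonFactors_flatten (isLyndonList_nil (S := S))
  rw [h, ← List.flatten_nil, h2] at h1
  exact (pow_pos (Fact.out : p.Prime).pos j).ne
    (by simpa only [List.length_nil, List.length_replicate] using congrArg List.length h1)

/-- All Lyndon factors of a product of words in `TL`, with multiplicity. -/
noncomputable def allFactors (M : Multiset (TL p S)) : Multiset (List S) :=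
  M.bind fun w => (lyndonFactors w.1 : Multiset (List S))

theorem allFactors_cons (w : TL p S) (M : Multiset (TL p S)) :
    allFactors (w ::ₘ M) = (lyndonFactors w.1 : Multiset (List S)) + allFactors M :=
  Multiset.cons_bind _ _ _

theorem allFactors_add (M N : Multiset (TL p S)) :
    allFactors (M + N) = allFactors M + allFactors N :=
  Multiset.add_bind _ _ _

theorem isLyndon_of_mem_allFactors {M : Multiset (TL p S)} {l : List S} (h : l ∈ allFactors M) :
    IsLyndon l := by
  obtain ⟨w, -, hw⟩ := Multiset.mem_bind.1 h
  exact (isLyndonList_lyndonFactors w.1).2 l (by simpa using hw)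

/-- The word `l^{⊗ p ^ i}` contributes `p ^ i` factors `l`; the sum is finite because `M` is. -/
theorem exists_count_allFactors [Fact p.Prime] (M : Multiset (TL p S)) {l : List S}
    (hl : IsLyndon l) : ∃ K, ∀ K' ≥ K, (allFactors M).count l =
      ∑ i ∈ Finset.range K', M.count (TL.mk hl i) * p ^ i := by
  classical
  induction M using Multiset.induction_on with
  | empty => exact ⟨0, fun K' _ => by simp [allFactors]⟩
  | cons w M ih =>
    obtain ⟨K, hK⟩ := ih
    obtain ⟨m, hm, j, rfl⟩ := TL.exists_eq_mk w
    refine ⟨max K (j + 1), fun K' hK' => ?_⟩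
    rw [allFactors_cons, Multiset.count_add, hK K' (by omega), TL.lyndonFactors_mk,
      Multiset.coe_replicate, Multiset.count_replicate]
    simp only [Multiset.count_cons, add_mul, Finset.sum_add_distrib, TL.mk_eq_mk_iff, ite_mul,
      one_mul, zero_mul]
    rw [add_comm]
    congr 1
    by_cases hlm : l = m
    · subst hlm
      simp only [true_and, if_true, Finset.sum_ite_eq', Finset.mem_range]
      rw [if_pos (by omega)]
    · simp [hlm, Ne.symm hlm]

/-- The multiplicities of the words `l^{⊗ p ^ j}` in a multiset, if they are all less than `p`, are
the base `p` digits of the total multiplicity of the Lyndon factor `l`. -/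
theorem count_allFactors_digit [Fact p.Prime] {M : Multiset (TL p S)} (hM : ∀ w, M.count w < p)
    {l : List S} (hl : IsLyndon l) (j : ℕ) :
    (allFactors M).count l / p ^ j % p = M.count (TL.mk hl j) := by
  obtain ⟨K, hK⟩ := exists_count_allFactors M hl
  rw [hK (max K (j + 1)) (le_max_left _ _)]
  exact sum_digits_div_mod (fun i => hM (TL.mk hl i)) (by omega)

theorem allFactors_injOn [Fact p.Prime] {M N : Multiset (TL p S)} (hM : ∀ w, M.count w < p)
    (hN : ∀ w, N.count w < p) (h : allFactors M = allFactors N) : M = N := by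
  refine Multiset.ext.2 fun w => ?_
  obtain ⟨l, hl, j, rfl⟩ := TL.exists_eq_mk w
  rw [← count_allFactors_digit hM, ← count_allFactors_digit hN, h]

/-- Every multiset of Lyndon words comes from a multiset in `TL` with multiplicities less than `p`:
in one of minimal cardinality, `p` copies of `l^{⊗ p ^ j}` could be replaced by one
`l^{⊗ p ^ (j + 1)}`. -/
theorem exists_allFactors_eq [Fact p.Prime] {A : Multiset (List S)} (hA : ∀ l ∈ A, IsLyndon l) :
    ∃ M : Multiset (TL p S), (∀ w, M.count w < p) ∧ allFactors M = A := by
  have hp : p.Prime := Fact.out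
  have hex : ∃ n, ∃ M : Multiset (TL p S), M.card = n ∧ allFactors M = A := by
    induction A using Multiset.induction_on with
    | empty => exact ⟨0, 0, rfl, Multiset.zero_bind _⟩
    | cons l A ih =>
      obtain ⟨-, M, -, rfl⟩ := ih fun m hm => hA m (Multiset.mem_cons_of_mem hm)
      refine ⟨_, TL.mk (hA l (Multiset.mem_cons_self l _)) 0 ::ₘ M, rfl, ?_⟩
      rw [allFactors_cons, TL.lyndonFactors_mk, pow_zero]
      rfl
  classical
  obtain ⟨M, hcard, hMA⟩ := Nat.find_spec hex
  refine ⟨M, fun w => ?_, hMA⟩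
  by_contra! hw
  obtain ⟨l, hl, j, rfl⟩ := TL.exists_eq_mk w
  obtain ⟨N, rfl⟩ := Multiset.le_iff_exists_add.1 (Multiset.le_count_iff_replicate_le.1 hw)
  refine Nat.find_min hex (m := (TL.mk hl (j + 1) ::ₘ N).card) ?_ ⟨_, rfl, ?_⟩
  · rw [← hcard, Multiset.card_cons, Multiset.card_add, Multiset.card_replicate, add_comm]
    exact Nat.add_lt_add_right hp.one_lt _
  · rw [← hMA, allFactors_cons, allFactors_add]
    congr 1
    rw [allFactors, Multiset.bind, Multiset.map_replicate, Multiset.join, Multiset.sum_replicate,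
      TL.lyndonFactors_mk, TL.lyndonFactors_mk, Multiset.coe_replicate, Multiset.coe_replicate,
      Multiset.nsmul_replicate, pow_succ']

end Factors

/-! ### The shuffle algebra as a truncated polynomial algebra -/

section TruncatedPolynomials

variable {p : ℕ} {S : Type*} [LinearOrder S]

/-- The nonincreasing product of all Lyndon factors of a multiset of words in `TL`. -/
noncomputable def leadingWord (M : Multiset (TL p S)) : List S :=
  ((allFactors M).sort (· ≥ ·)).flatten

theorem isLyndonList_sort_allFactors (M : Multiset (TL p S)) :
    IsLyndonList ((allFactors M).sort (· ≥ ·)) :=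
  ⟨Multiset.pairwise_sort _ _, fun _ h => isLyndon_of_mem_allFactors ((Multiset.mem_sort _).1 h)⟩

variable (p S) in
/-- The algebra map from polynomials in the words of `TL` that sends each variable to the
corresponding word. -/
noncomputable def wordHom : MvPolynomial (TL p S) (ZMod p) →ₐ[ZMod p] ShuffleAlgebra (ZMod p) S :=
  MvPolynomial.aeval fun w => ShuffleAlgebra.word (ZMod p) w.1

variable (p S) in
/-- The ideal generated by the `p`-th powers of the variables. -/
noncomputable def powIdeal : Ideal (MvPolynomial (TL p S) (ZMod p)) :=
  Ideal.span {f : MvPolynomial (TL p S) (ZMod p) | ∃ w, f = MvPolynomial.X w ^ p}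

variable [Fact p.Prime]

theorem leadingWord_injOn {M N : Multiset (TL p S)} (hM : ∀ w, M.count w < p)
    (hN : ∀ w, N.count w < p) (h : leadingWord M = leadingWord N) : M = N := by
  refine allFactors_injOn hM hN ?_
  have := (isLyndonList_sort_allFactors M).eq_of_flatten_eq (isLyndonList_sort_allFactors N) h
  rw [← Multiset.sort_eq (allFactors M) (· ≥ ·), this, Multiset.sort_eq]

theorem exists_leadingWord_eq (w : List S) :
    ∃ M : Multiset (TL p S), (∀ v, M.count v < p) ∧ leadingWord M = w := by
  obtain ⟨A, hA, rfl⟩ := exists_isLyndonList_flatten w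
  obtain ⟨M, hM, hMA⟩ := exists_allFactors_eq (p := p) (A := (A : Multiset (List S)))
    fun l hl => hA.2 l (by simpa using hl)
  refine ⟨M, hM, ?_⟩
  have : (allFactors M).sort (· ≥ ·) = A := by
    refine (isLyndonList_sort_allFactors M).eq_of_perm hA ?_
    rw [← Multiset.coe_eq_coe, Multiset.sort_eq, hMA]
  rw [leadingWord, this]

/-- A product of words in `TL` with multiplicities less than `p` has a leading term whose
coefficient is a product of binomial coefficients without carries, hence nonzero. -/
theorem exists_hasLeadingTerm_prod (M : Multiset (TL p S)) (hM : ∀ w, M.count w < p) :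
    ∃ c : ZMod p, c ≠ 0 ∧ ShuffleAlgebra.HasLeadingTerm
      (M.map fun w => ShuffleAlgebra.word (ZMod p) w.1).prod c (leadingWord M) := by
  classical
  induction M using Multiset.induction_on with
  | empty =>
    refine ⟨1, one_ne_zero, ?_⟩
    simpa [leadingWord, allFactors] using ShuffleAlgebra.hasLeadingTerm_one
  | cons w M ih =>
    have hM' : ∀ v, M.count v < p := fun v =>
      (Multiset.count_le_of_le v (Multiset.le_cons_self M w)).trans_lt (hM v)
    obtain ⟨c, hc, hlead⟩ := ih hM'
    obtain ⟨l, hl, j, rfl⟩ := TL.exists_eq_mk w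
    have hperm : (List.replicate (p ^ j) l ++ (allFactors M).sort (· ≥ ·)).Perm
        ((allFactors (TL.mk hl j ::ₘ M)).sort (· ≥ ·)) := by
      rw [← Multiset.coe_eq_coe, ← Multiset.coe_add, Multiset.sort_eq, Multiset.sort_eq,
        allFactors_cons, TL.lyndonFactors_mk]
    have hcount := shuffleCount_tensorPow_flatten hl (p ^ j) (isLyndonList_sort_allFactors M)
      (isLyndonList_sort_allFactors _) hperm
    have hndvd : ¬ p ∣ shuffleCount (tensorPow l (p ^ j)) (leadingWord M)
        (leadingWord (TL.mk hl j ::ₘ M)) := by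
      rw [leadingWord, leadingWord, hcount]
      refine not_dvd_choose_pow_add j _ ?_
      rw [Multiset.sort_eq, count_allFactors_digit hM' hl j]
      simpa using hM (TL.mk hl j)
    rw [Multiset.map_cons, Multiset.prod_cons]
    refine ⟨_, mul_ne_zero hc ?_, hlead.word_mul (fun s hs => shuffle_le_flatten
      (isLyndonList_replicate hl (p ^ j)) (isLyndonList_sort_allFactors M)
      (isLyndonList_sort_allFactors _) hperm hs) fun h => hndvd (h ▸ dvd_zero p)⟩
    rwa [Ne, ZMod.natCast_eq_zero_iff]

theorem wordHom_monomial (e : TL p S →₀ ℕ) :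
    wordHom p S (MvPolynomial.monomial e 1)
      = (e.toMultiset.map fun w => ShuffleAlgebra.word (ZMod p) w.1).prod := by
  rw [wordHom, MvPolynomial.aeval_monomial, map_one, one_mul, Finsupp.toMultiset_map,
    Finsupp.prod_toMultiset, Finsupp.prod_mapDomain_index (by simp) (by simp [pow_add])]

theorem wordHom_surjective [Finite S] : Function.Surjective (wordHom p S) := by
  rw [← AlgHom.coe_toLinearMap, ← LinearMap.range_eq_top]
  refine ShuffleAlgebra.submodule_eq_top_of_hasLeadingTerm _ fun w => ?_
  classical
  obtain ⟨M, hM, rfl⟩ := exists_leadingWord_eq (p := p) w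
  obtain ⟨c, hc, h⟩ := exists_hasLeadingTerm_prod M hM
  refine ⟨_, ⟨MvPolynomial.monomial (Multiset.toFinsupp M) 1, ?_⟩, c, hc, h⟩
  rw [AlgHom.coe_toLinearMap, wordHom_monomial, Multiset.toFinsupp_toMultiset]

theorem wordHom_eq_zero_of_mem {f : MvPolynomial (TL p S) (ZMod p)} (hf : f ∈ powIdeal p S) :
    wordHom p S f = 0 := by
  have : powIdeal p S ≤ RingHom.ker (wordHom p S) := by
    refine Ideal.span_le.2 ?_
    rintro _ ⟨w, rfl⟩
    rw [SetLike.mem_coe, RingHom.mem_ker, map_pow, wordHom, MvPolynomial.aeval_X]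
    exact ShuffleAlgebra.word_pow_char_eq_zero p (TL.ne_nil w)
  exact this hf

theorem monomial_mem_powIdeal {e : TL p S →₀ ℕ} {w : TL p S} (h : p ≤ e w) (c : ZMod p) :
    MvPolynomial.monomial e c ∈ powIdeal p S := by
  have he : e = (e - Finsupp.single w p) + Finsupp.single w p :=
    (tsub_add_cancel_of_le (Finsupp.single_le_iff.2 h)).symm
  have : MvPolynomial.monomial e c
      = MvPolynomial.monomial (e - Finsupp.single w p) c * MvPolynomial.X w ^ p := by
    rw [MvPolynomial.X_pow_eq_monomial, MvPolynomial.monomial_mul, mul_one, ← he]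
  rw [this]
  exact Ideal.mul_mem_left _ _ (Ideal.subset_span ⟨w, rfl⟩)

/-- Modulo the `p`-th powers of the variables only the monomials with exponents less than `p`
remain, and their images are linearly independent. -/
theorem mem_powIdeal_of_wordHom_eq_zero {f : MvPolynomial (TL p S) (ZMod p)}
    (hf : wordHom p S f = 0) : f ∈ powIdeal p S := by
  classical
  have hsum := f.support_sum_monomial_coeff
  rw [← Finset.sum_filter_add_sum_filter_not f.support fun e => ∀ w, e w < p] at hsum
  have hbig : ∑ e ∈ f.support.filter (fun e => ¬ ∀ w, e w < p),
      MvPolynomial.monomial e (f.coeff e) ∈ powIdeal p S := by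
    refine Ideal.sum_mem _ fun e he => ?_
    obtain ⟨w, hw⟩ := not_forall.1 (Finset.mem_filter.1 he).2
    exact monomial_mem_powIdeal (not_lt.1 hw) _
  have hsmall : ∑ e ∈ f.support.filter (fun e => ∀ w, e w < p),
      f.coeff e • wordHom p S (MvPolynomial.monomial e 1) = 0 := by
    rw [← hsum, map_add, wordHom_eq_zero_of_mem hbig, add_zero, map_sum] at hf
    rw [← hf]
    refine Finset.sum_congr rfl fun e _ => ?_
    rw [← map_smul, MvPolynomial.smul_monomial, smul_eq_mul, mul_one]
  have hcount : ∀ e ∈ f.support.filter (fun e => ∀ w, e w < p),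
      ∀ w, (Finsupp.toMultiset e).count w < p := fun e he w => by
    rw [Finsupp.count_toMultiset]
    exact (Finset.mem_filter.1 he).2 w
  choose! c hc hlead using fun (M : Multiset (TL p S)) => exists_hasLeadingTerm_prod M
  have hzero := ShuffleAlgebra.eq_zero_of_sum_smul_eq_zero
    (c := fun e => c (Finsupp.toMultiset e)) (w := fun e => leadingWord (Finsupp.toMultiset e))
    (fun e he => by
      rw [wordHom_monomial]
      exact hlead _ (hcount e he))
    (fun e he => hc _ (hcount e he))
    (fun e he e' he' h => Multiset.toFinsupp.symm.injective
      (leadingWord_injOn (hcount e he) (hcount e' he') h)) hsmall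
  rw [← hsum, Finset.sum_eq_zero fun e he => by rw [hzero e he, map_zero], zero_add]
  exact hbig

variable (p S) in
/-- The shuffle algebra is the truncated polynomial algebra on the words of `TL`. -/
noncomputable def truncatedEquivShuffle [Finite S] :
    (MvPolynomial (TL p S) (ZMod p) ⧸ powIdeal p S) ≃ₐ[ZMod p] ShuffleAlgebra (ZMod p) S :=
  AlgEquiv.ofBijective (Ideal.Quotient.liftₐ _ (wordHom p S) fun _ => wordHom_eq_zero_of_mem) <| by
    refine ⟨(injective_iff_map_eq_zero _).2 fun x hx => ?_, fun y => ?_⟩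
    · obtain ⟨f, rfl⟩ := Ideal.Quotient.mk_surjective x
      exact Ideal.Quotient.eq_zero_iff_mem.2 (mem_powIdeal_of_wordHom_eq_zero hx)
    · obtain ⟨f, rfl⟩ := wordHom_surjective y
      exact ⟨Ideal.Quotient.mk _ f, rfl⟩

theorem truncatedEquivShuffle_mk_X [Finite S] (w : TL p S) :
    truncatedEquivShuffle p S (Ideal.Quotient.mk _ (MvPolynomial.X w))
      = ShuffleAlgebra.word (ZMod p) w.1 :=
  MvPolynomial.aeval_X _ w

end TruncatedPolynomials

/-! ### Truncated polynomial algebras as tensor products -/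

namespace AlgTensor

section Lift

variable {k : Type*} [CommRing k] {ι : Type*} {A : ι → Type*}
  [∀ i, CommRing (A i)] [∀ i, Algebra k (A i)] {B : Type*} [CommRing B] [Algebra k B]

open Classical in
theorem of_def (i : ι) (a : A i) :
    of k A i a = ofFinset k A {i} (PiTensorProduct.tprod k
      (Pi.mulSingle (⟨i, Finset.mem_singleton_self i⟩ : ({i} : Finset ι)) a)) :=
  rfl

theorem ofFinset_transition (s t : Finset ι) (hst : s ≤ t) (x : ⨂[k] i : s, A i) :
    ofFinset k A t (transition k A s t hst x) = ofFinset k A s x :=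
  (Quotient.sound (DirectLimit.r_of_le (fun s t h => transition k A s t h)
    (⟨s, x⟩ : Σ s : Finset ι, ⨂[k] i : s, A i) t hst)).symm

theorem ofFinset_surjective (x : AlgTensor k A) : ∃ s y, x = ofFinset k A s y :=
  DirectLimit.exists_eq_mk _ x

/-- An algebra map out of the tensor product is determined by its values on the factors. -/
theorem algHom_ext {f g : AlgTensor k A →ₐ[k] B} (h : ∀ i a, f (of k A i a) = g (of k A i a)) :
    f = g := by
  classical
  refine AlgHom.ext fun x => ?_
  obtain ⟨s, y, rfl⟩ := ofFinset_surjective x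
  refine AlgHom.congr_fun (PiTensorProduct.algHom_ext (f := f.comp (ofFinset k A s))
    (g := g.comp (ofFinset k A s)) fun i => AlgHom.ext fun a => ?_) y
  have key : ofFinset k A s (PiTensorProduct.singleAlgHom (A := fun j : s => A j) i a)
      = of k A i.1 a := by
    rw [of_def, ← ofFinset_transition {i.1} s (by simp), transition_tprod]
    refine congrArg (fun x => ofFinset k A s (PiTensorProduct.tprod k x)) ?_
    funext j
    rw [MonoidHom.mulSingle_apply]
    by_cases hj : j = i
    · subst hj
      simp [extendOne]
    · have : j.1 ≠ i.1 := fun h => hj (Subtype.ext h)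
      simp [extendOne, hj, this]
  exact (congrArg f key).trans ((h i.1 a).trans (congrArg g key.symm))

/-- The algebra map `⊗ xᵢ ↦ ∏ fᵢ(xᵢ)` on the tensor product of a finite subfamily. -/
noncomputable def liftFinset (f : ∀ i, A i →ₐ[k] B) (s : Finset ι) : (⨂[k] i : s, A i) →ₐ[k] B :=
  PiTensorProduct.liftAlgHom
    ((MultilinearMap.mkPiAlgebra k s B).compLinearMap fun i => (f i.1).toLinearMap)
    (by simp) (by simp [Finset.prod_mul_distrib])

theorem liftFinset_tprod (f : ∀ i, A i →ₐ[k] B) (s : Finset ι) (x : ∀ i : s, A i) :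
    liftFinset f s (PiTensorProduct.tprod k x) = ∏ i : s, f i.1 (x i) := by
  refine (PiTensorProduct.lift.tprod _).trans ?_
  rw [MultilinearMap.compLinearMap_apply, MultilinearMap.mkPiAlgebra_apply]
  rfl

theorem liftFinset_transition (f : ∀ i, A i →ₐ[k] B) (s t : Finset ι) (hst : s ≤ t)
    (x : ⨂[k] i : s, A i) : liftFinset f t (transition k A s t hst x) = liftFinset f s x := by
  classical
  have h : (liftFinset f t).toLinearMap ∘ₗ (transition k A s t hst).toLinearMap
      = (liftFinset f s).toLinearMap := by
    refine PiTensorProduct.ext (MultilinearMap.ext fun x => ?_)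
    change liftFinset f t (transition k A s t hst (PiTensorProduct.tprod k x))
      = liftFinset f s (PiTensorProduct.tprod k x)
    rw [transition_tprod, liftFinset_tprod, liftFinset_tprod]
    let F : ι → B := fun i => if h : i ∈ s then f i (x ⟨i, h⟩) else 1
    have ht : ∀ i : t, f i.1 (extendOne A x i) = F i.1 := by
      intro i
      by_cases hi : i.1 ∈ s <;> simp [F, extendOne, hi]
    have hs : ∀ i : s, f i.1 (x i) = F i.1 := fun i => by simp [F]
    simp only [ht, hs, Finset.prod_coe_sort]
    exact (Finset.prod_subset hst fun i _ hi => by simp [F, hi]).symm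
  exact LinearMap.congr_fun h x

/-- The universal property of the tensor product of a family of commutative algebras. -/
noncomputable def lift (f : ∀ i, A i →ₐ[k] B) : AlgTensor k A →ₐ[k] B where
  toFun := DirectLimit.lift _ (fun s x => liftFinset f s x)
    fun s t hst x => (liftFinset_transition f s t hst x).symm
  map_one' := by
    rw [← mk_one k A ∅]
    exact map_one (liftFinset f ∅)
  map_mul' x y := by
    obtain ⟨s, x, y, rfl, rfl⟩ := DirectLimit.exists_eq_mk₂ _ x y
    exact (congrArg _ (mk_mul k A s x y).symm).trans (map_mul (liftFinset f s) x y)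
  map_zero' := by
    have : (0 : AlgTensor k A) = mk k A ∅ 0 := (map_zero (ofFinset k A ∅)).symm
    rw [this]
    exact map_zero (liftFinset f ∅)
  map_add' x y := by
    obtain ⟨s, x, y, rfl, rfl⟩ := DirectLimit.exists_eq_mk₂ _ x y
    exact (congrArg _ (mk_add k A s x y).symm).trans (map_add (liftFinset f s) x y)
  commutes' c := by
    have : algebraMap k (AlgTensor k A) c = mk k A ∅ (algebraMap k _ c) :=
      ((ofFinset k A ∅).commutes c).symm
    rw [this]
    exact (liftFinset f ∅).commutes c

theorem lift_of (f : ∀ i, A i →ₐ[k] B) (i : ι) (a : A i) : lift f (of k A i a) = f i a := by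
  classical
  rw [of_def]
  refine (liftFinset_tprod f {i} _).trans ?_
  rw [Finset.prod_eq_single (⟨i, Finset.mem_singleton_self i⟩ : ({i} : Finset ι))]
  · simp
  · rintro ⟨j, hj⟩ - h
    exact absurd (Subtype.ext (Finset.mem_singleton.1 hj)) h
  · exact fun h => absurd (Finset.mem_univ _) h

end Lift

section Truncated

variable (k : Type*) [CommRing k] (ι : Type*) (n : ℕ)

/-- The forward half of `truncatedEquiv`: a variable goes to the generator of its factor. -/
noncomputable def ofTruncated :
    (MvPolynomial ι k ⧸ Ideal.span {f : MvPolynomial ι k | ∃ i, f = MvPolynomial.X i ^ n})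
      →ₐ[k] AlgTensor k (fun _ : ι =>
        Polynomial k ⧸ Ideal.span {(Polynomial.X : Polynomial k) ^ n}) :=
  Ideal.Quotient.liftₐ _
    (MvPolynomial.aeval fun i => of k (fun _ : ι =>
      Polynomial k ⧸ Ideal.span {(Polynomial.X : Polynomial k) ^ n}) i
        (Ideal.Quotient.mk _ Polynomial.X)) <| by
    intro f hf
    refine (Ideal.span_le (I := RingHom.ker _)).2 ?_ hf
    rintro _ ⟨i, rfl⟩
    rw [SetLike.mem_coe, RingHom.mem_ker, map_pow, MvPolynomial.aeval_X, ← map_pow, ← map_pow,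
      Ideal.Quotient.eq_zero_iff_mem.2 (Ideal.mem_span_singleton_self _), map_zero]

theorem ofTruncated_mk_X (i : ι) :
    ofTruncated k ι n (Ideal.Quotient.mk _ (MvPolynomial.X i))
      = of k (fun _ : ι => Polynomial k ⧸ Ideal.span {(Polynomial.X : Polynomial k) ^ n}) i
        (Ideal.Quotient.mk _ Polynomial.X) :=
  MvPolynomial.aeval_X _ i

/-- The backward half of `truncatedEquiv`: the generator of a factor goes to its variable. -/
noncomputable def toTruncated :
    AlgTensor k (fun _ : ι => Polynomial k ⧸ Ideal.span {(Polynomial.X : Polynomial k) ^ n})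
      →ₐ[k] (MvPolynomial ι k ⧸
        Ideal.span {f : MvPolynomial ι k | ∃ i, f = MvPolynomial.X i ^ n}) :=
  lift fun i => Ideal.Quotient.liftₐ _
    (Polynomial.aeval (Ideal.Quotient.mk _ (MvPolynomial.X i))) <| by
    intro f hf
    refine (Ideal.span_le (I := RingHom.ker _)).2 ?_ hf
    rintro _ rfl
    rw [SetLike.mem_coe, RingHom.mem_ker, map_pow, Polynomial.aeval_X, ← map_pow]
    exact Ideal.Quotient.eq_zero_iff_mem.2 (Ideal.subset_span ⟨i, rfl⟩)

theorem toTruncated_of_mk_X (i : ι) :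
    toTruncated k ι n (of k (fun _ : ι =>
      Polynomial k ⧸ Ideal.span {(Polynomial.X : Polynomial k) ^ n}) i
        (Ideal.Quotient.mk _ Polynomial.X)) = Ideal.Quotient.mk _ (MvPolynomial.X i) :=
  (lift_of _ i _).trans (Polynomial.aeval_X _)

/-- The truncated polynomial algebra is the tensor product of the truncated polynomial algebras in
the single variables. -/
noncomputable def truncatedEquiv :
    (MvPolynomial ι k ⧸ Ideal.span {f : MvPolynomial ι k | ∃ i, f = MvPolynomial.X i ^ n})
      ≃ₐ[k] AlgTensor k (fun _ : ι =>
        Polynomial k ⧸ Ideal.span {(Polynomial.X : Polynomial k) ^ n}) :=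
  AlgEquiv.ofAlgHom (ofTruncated k ι n) (toTruncated k ι n)
    (by
      refine algHom_ext fun i a => ?_
      obtain ⟨a, rfl⟩ := Ideal.Quotient.mk_surjective a
      refine AlgHom.congr_fun (φ₁ := (((ofTruncated k ι n).comp (toTruncated k ι n)).comp
        (of k _ i)).comp (Ideal.Quotient.mkₐ k _)) (φ₂ := ((AlgHom.id k _).comp
        (of k _ i)).comp (Ideal.Quotient.mkₐ k _)) (Polynomial.algHom_ext ?_) a
      exact (congrArg (ofTruncated k ι n) (toTruncated_of_mk_X k ι n i)).trans
        (ofTruncated_mk_X k ι n i))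
    (by
      refine Ideal.Quotient.algHom_ext _ (MvPolynomial.algHom_ext fun i => ?_)
      exact (congrArg (toTruncated k ι n) (ofTruncated_mk_X k ι n i)).trans
        (toTruncated_of_mk_X k ι n i))

end Truncated

end AlgTensor

theorem mainTheorem8 (p : ℕ) [Fact p.Prime] (S : Type*) [LinearOrder S] [Finite S] :
    (∃ φ : (MvPolynomial (TL p S) (ZMod p) ⧸
          Ideal.span {f : MvPolynomial (TL p S) (ZMod p) | ∃ w, f = MvPolynomial.X w ^ p})
        ≃ₐ[ZMod p] ShuffleAlgebra (ZMod p) S,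
      ∀ w : TL p S,
        φ (Ideal.Quotient.mk _ (MvPolynomial.X w)) = ShuffleAlgebra.word (ZMod p) w.1) ∧
    (∃ ψ : (MvPolynomial (TL p S) (ZMod p) ⧸
          Ideal.span {f : MvPolynomial (TL p S) (ZMod p) | ∃ w, f = MvPolynomial.X w ^ p})
        ≃ₐ[ZMod p] AlgTensor (ZMod p) (fun _ : TL p S =>
          Polynomial (ZMod p) ⧸ Ideal.span {(Polynomial.X : Polynomial (ZMod p)) ^ p}),
      ∀ w : TL p S,
        ψ (Ideal.Quotient.mk _ (MvPolynomial.X w)) =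
          AlgTensor.of (ZMod p) (fun _ : TL p S =>
            Polynomial (ZMod p) ⧸ Ideal.span {(Polynomial.X : Polynomial (ZMod p)) ^ p})
            w (Ideal.Quotient.mk _ Polynomial.X)) :=
  ⟨⟨truncatedEquivShuffle p S, truncatedEquivShuffle_mk_X⟩,
    ⟨AlgTensor.truncatedEquiv (ZMod p) (TL p S) p,
      AlgTensor.ofTruncated_mk_X (ZMod p) (TL p S) p⟩⟩
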